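/- Let $n_1,n_2\ge 1$ be integers, let $\Omega_i\subset\mathbb R^{n_i}$ ($i=1,2$) be bounded open sets (for example, sufficiently smooth bounded domains), and let $s_1,s_2>0$ be real. For $s\ge 0$, $H^s(\mathbb R^n)$ is the Hilbert space of real-valued $u\in L^2(\mathbb R^n)$ with $\|u\|_{H^s(\mathbb R^n)}^2=\int_{\mathbb R^n}(1+|\xi|^2)^{s}|\hat u(\xi)|^2\,d\xi<\infty$, where $\hat u(\xi)=\int u(x)e^{-2\pi i x\cdot\xi}\,dx$ is the Fourier transform, and $H^s(\Omega)$ is the Hilbert space of restrictions to $\Omega$ of functions in $H^s(\mathbb R^n)$, with the norm $\|u\|_{H^s(\Omega)}=\inf\{\|U\|_{H^s(\mathbb R^n)}: U|_\Omega=u\}$ (on smooth bounded domains this is the usual Sobolev space, up to equivalence of norms). Let $H^{s_1,s_2}_{mix}(\Omega_1\times\Omega_2)=H^{s_1}(\Omega_1)\otimes H^{s_2}(\Omega_2)$ be the Hilbert space tensor product with its cross norm, regarded as a space of functions in $L^2(\Omega_1\times\Omega_2)$. For $\sigma>0$ set $$\beta=\beta(\sigma):=\frac{n_1/\sigma+\sigma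 n_2}{n_1n_2}\,\min\Big\{\frac{s_1}{\sigma},\,s_2\sigma\Big\}.$$ (a) For every $\sigma>0$, $$\beta(\sigma)=\frac1{n_1n_2}\min\Big\{\frac{s_1n_1}{\sigma^2}+s_1n_2,\ s_2n_1+s_2n_2\sigma^2\Big\},$$ and there is a constant $C>0$, independent of $f$ and $R$, such that for every $f\in H^{s_1,s_2}_{mix}(\Omega_1\times\Omega_2)$ and every integer $R\ge1$ (respectively $R\ge 2$ in the second case) there are $g^{(1)}_1,\dots,g^{(1)}_R\in L^2(\Omega_1)$ and $g^{(2)}_1,\dots,g^{(2)}_R\in L^2(\Omega_2)$ for which $f_R(x_1,x_2)=\sum_{r=1}^R g^{(1)}_r(x_1)\,g^{(2)}_r(x_2)$ satisfies $$\|f-f_R\|_{L^2(\Omega_1\times\Omega_2)}\le\begin{cases}C\,R^{-\beta}\,\|f\|_{H^{s_1,s_2}_{mix}}, & \text{if } s_1/\sigma\ne s_2\sigma,\\[2pt] C\,R^{-\beta}\sqrt{\log R}\;\|f\|_{H^{s_1,s_2}_{mix}}, & \text{if } s_1/\sigma=s_2\sigma.\end{cases}$$ (b) For $\sigma=\sqrt{s_1/s_2}$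 one has $\beta=\frac{s_1}{n_1}+\frac{s_2}{n_2}$. Consequently there is a constant $C>0$ such that every $f\in H^{s_1,s_2}_{mix}(\Omega_1\times\Omega_2)$ and every integer $R\ge2$ admit such an $f_R$ with $$\|f-f_R\|_{L^2(\Omega_1\times\Omega_2)}\le C\,R^{-(s_1/n_1+s_2/n_2)}\sqrt{\log R}\;\|f\|_{H^{s_1,s_2}_{mix}}.$$ -/

import Mathlib

open MeasureTheory FourierTransform UniformSpace
open scoped ENNReal NNReal TensorProduct

noncomputable section

namespace MixedSobolev

/-- The real Hilbert space of real-valued square integrable functions for the measure `μ`. -/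
abbrev RealL2 {α : Type*} [MeasurableSpace α] (μ : Measure α) : Type _ := Lp ℝ 2 μ

/-- Euclidean space of dimension `n`. -/
abbrev Euc (n : ℕ) : Type := EuclideanSpace ℝ (Fin n)

/-! ### The Sobolev space on the whole space -/

/-- Fourier transform of a real-valued square integrable function on Euclidean space, as a
real-linear isometry into the complex-valued square integrable functions. -/
def realFourier (n : ℕ) :
    RealL2 (volume : Measure (Euc n)) →ₗᵢ[ℝ] Lp ℂ 2 (volume : Measure (Euc n)) where
  toFun u := 𝓕 (Complex.ofRealCLM.compLp u)
  map_add' u v := by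
    have h : Complex.ofRealCLM.compLp (u + v)
        = Complex.ofRealCLM.compLp u + Complex.ofRealCLM.compLp v :=
      (Complex.ofRealCLM.compLpL 2 volume).map_add u v
    rw [h, FourierTransform.fourier_add]
  map_smul' c u := by
    have h : Complex.ofRealCLM.compLp (c • u) = (c : ℂ) • Complex.ofRealCLM.compLp u :=
      (Complex.ofRealCLM.compLpL 2 volume).map_smul c u
    rw [h, FourierTransform.fourier_smul]
    rfl
  norm_map' u := by
    change ‖𝓕 (Complex.ofRealCLM.compLp u)‖ = ‖u‖
    rw [Lp.norm_fourier_eq, Lp.norm_def, Lp.norm_def]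
    congr 1
    refine eLpNorm_congr_norm_ae ?_
    filter_upwards [Complex.ofRealCLM.coeFn_compLp u] with x hx
    simp [hx]

/-- The function `ξ ↦ (1 + ‖ξ‖²)^(-s/2)`. -/
def besselWeight (n : ℕ) (s : ℝ≥0) (ξ : Euc n) : ℝ := (1 + ‖ξ‖ ^ 2) ^ (-(s : ℝ) / 2)

theorem besselWeight_memLp (n : ℕ) (s : ℝ≥0) :
    MemLp (besselWeight n s) ∞ (volume : Measure (Euc n)) := by
  refine memLp_top_of_bound (Measurable.aestronglyMeasurable ?_) 1 (.of_forall fun ξ => ?_)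
  · unfold besselWeight
    fun_prop
  · rw [besselWeight, Real.norm_of_nonneg (by positivity)]
    refine Real.rpow_le_one_of_one_le_of_nonpos (by nlinarith [sq_nonneg ‖ξ‖]) ?_
    have : (0 : ℝ) ≤ s := s.2
    linarith

/-- Multiplication by `ξ ↦ (1 + ‖ξ‖²)^(-s/2)` on the complex-valued square integrable functions. -/
def besselMul (n : ℕ) (s : ℝ≥0) :
    Lp ℂ 2 (volume : Measure (Euc n)) →L[ℝ] Lp ℂ 2 (volume : Measure (Euc n)) :=
  (ContinuousLinearMap.lsmul ℝ ℝ : ℝ →L[ℝ] ℂ →L[ℝ] ℂ).holderL volume ∞ 2 2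
    ((besselWeight_memLp n s).toLp _)

theorem besselMul_coeFn (n : ℕ) (s : ℝ≥0) (w : Lp ℂ 2 (volume : Measure (Euc n))) :
    besselMul n s w =ᵐ[volume] fun ξ => besselWeight n s ξ • w ξ := by
  filter_upwards [(ContinuousLinearMap.lsmul ℝ ℝ : ℝ →L[ℝ] ℂ →L[ℝ] ℂ).coeFn_holder (r := 2)
    ((besselWeight_memLp n s).toLp _) w, (besselWeight_memLp n s).coeFn_toLp] with ξ h1 h2
  rw [h2] at h1
  exact h1

/-- The Sobolev space `H^s(ℝⁿ)` of real-valued functions, `s ≥ 0`. A function `u` is recorded by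
`w = (1 + ‖ξ‖²)^(s/2) û`, so the space consists of those `w` in `L²` for which `(1 + ‖ξ‖²)^(-s/2) w`
is the Fourier transform of a real-valued `u` in `L²`. The inner product and the norm
`(∫ (1 + ‖ξ‖²)^s |û(ξ)|² dξ)^(1/2)` are those of `L²` applied to `w`. -/
abbrev SobolevRn (n : ℕ) (s : ℝ≥0) : Submodule ℝ (Lp ℂ 2 (volume : Measure (Euc n))) :=
  (LinearMap.range (realFourier n).toLinearMap).comap (besselMul n s).toLinearMap

/-- The square integrable function `u` recorded by an element of `H^s(ℝⁿ)`. -/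
def SobolevRn.toL2 (n : ℕ) (s : ℝ≥0) :
    SobolevRn n s →L[ℝ] RealL2 (volume : Measure (Euc n)) :=
  ((realFourier n).equivRange.symm : _ →L[ℝ] RealL2 (volume : Measure (Euc n))) ∘L
    ((besselMul n s) ∘L (SobolevRn n s).subtypeL).codRestrict
      (LinearMap.range (realFourier n).toLinearMap) (fun w => w.2)

theorem SobolevRn.realFourier_toL2 (n : ℕ) (s : ℝ≥0) (w : SobolevRn n s) :
    realFourier n (SobolevRn.toL2 n s w) = besselMul n s w := by
  have := congrArg Subtype.val ((realFourier n).equivRange.apply_symm_apply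
    ⟨besselMul n s w, w.2⟩)
  exact this

/-- An element of `H^s(ℝⁿ)` is the weighted Fourier transform `(1 + ‖ξ‖²)^(s/2) û` of the
function `u` that it records. -/
theorem SobolevRn.coe_ae_eq (n : ℕ) (s : ℝ≥0) (w : SobolevRn n s) :
    (w : Lp ℂ 2 (volume : Measure (Euc n))) =ᵐ[volume]
      fun ξ => ((1 + ‖ξ‖ ^ 2) ^ ((s : ℝ) / 2) : ℝ) • realFourier n (SobolevRn.toL2 n s w) ξ := by
  rw [SobolevRn.realFourier_toL2]
  filter_upwards [besselMul_coeFn n s w] with ξ hξ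
  rw [hξ, besselWeight, smul_smul, ← Real.rpow_add (by positivity)]
  simp [neg_div]

instance SobolevRn.completeSpace (n : ℕ) (s : ℝ≥0) : CompleteSpace (SobolevRn n s) := by
  have h1 : IsClosed (Set.range (realFourier n)) :=
    (realFourier n).isometry.isClosedEmbedding.isClosed_range
  have h2 : IsClosed ((SobolevRn n s : Submodule ℝ (Lp ℂ 2 (volume : Measure (Euc n)))) :
      Set (Lp ℂ 2 (volume : Measure (Euc n)))) := by
    have : ((SobolevRn n s : Submodule ℝ (Lp ℂ 2 (volume : Measure (Euc n)))) :
      Set (Lp ℂ 2 (volume : Measure (Euc n)))) = besselMul n s ⁻¹' (Set.range (realFourier n)) := by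
      ext; simp
    rw [this]
    exact h1.preimage (besselMul n s).continuous
  exact h2.completeSpace_coe

/-! ### The Sobolev space on a domain -/

/-- Restriction of functions in `H^s(ℝⁿ)` to `Ω`. -/
def restrictL2 (n : ℕ) (s : ℝ≥0) (Ω : Set (Euc n)) :
    SobolevRn n s →L[ℝ] RealL2 (volume.restrict Ω) :=
  (LpToLpRestrictCLM (Euc n) ℝ ℝ volume 2 Ω) ∘L SobolevRn.toL2 n s

/-- The functions in `H^s(ℝⁿ)` that vanish almost everywhere on `Ω`. -/
abbrev vanishing (n : ℕ) (s : ℝ≥0) (Ω : Set (Euc n)) : Submodule ℝ (SobolevRn n s) :=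
  LinearMap.ker (restrictL2 n s Ω).toLinearMap

instance vanishing.completeSpace (n : ℕ) (s : ℝ≥0) (Ω : Set (Euc n)) :
    CompleteSpace (vanishing n s Ω) :=
  (restrictL2 n s Ω).isClosed_ker.completeSpace_coe

instance vanishing.isClosed (n : ℕ) (s : ℝ≥0) (Ω : Set (Euc n)) :
    IsClosed ((vanishing n s Ω : Submodule ℝ (SobolevRn n s)) : Set (SobolevRn n s)) :=
  (restrictL2 n s Ω).isClosed_ker

/-- The Sobolev space `H^s(Ω)`: restrictions to `Ω` of functions in `H^s(ℝⁿ)`, with the quotient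
norm `‖u‖ = inf {‖U‖ : U ∈ H^s(ℝⁿ), U = u on Ω}` and the corresponding inner product. -/
def SobolevOn (n : ℕ) (s : ℝ≥0) (Ω : Set (Euc n)) : Type :=
  SobolevRn n s ⧸ vanishing n s Ω

instance SobolevOn.normedAddCommGroup (n : ℕ) (s : ℝ≥0) (Ω : Set (Euc n)) :
    NormedAddCommGroup (SobolevOn n s Ω) :=
  inferInstanceAs (NormedAddCommGroup (SobolevRn n s ⧸ vanishing n s Ω))

instance SobolevOn.innerProductSpace (n : ℕ) (s : ℝ≥0) (Ω : Set (Euc n)) :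
    InnerProductSpace ℝ (SobolevOn n s Ω) :=
  Submodule.instQuotientInnerProductSpace (𝕜 := ℝ) (vanishing n s Ω)

/-- The embedding of `H^s(Ω)` into `L²(Ω)`. -/
def SobolevOn.toL2 (n : ℕ) (s : ℝ≥0) (Ω : Set (Euc n)) :
    SobolevOn n s Ω →L[ℝ] RealL2 (volume.restrict Ω) :=
  (vanishing n s Ω).liftQL (restrictL2 n s Ω) le_rfl

/-! ### Separable functions and the mixed space -/

section Product

set_option linter.unusedSectionVars false

variable {α β : Type*} [MeasurableSpace α] [MeasurableSpace β]
  (μ : Measure α) (ν : Measure β) [SFinite μ] [SFinite ν]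

theorem memLp_mul_prod (u : RealL2 μ) (v : RealL2 ν) :
    MemLp (fun z : α × β => u z.1 * v z.2) 2 (μ.prod ν) := by
  have hm : AEStronglyMeasurable (fun z : α × β => u z.1 * v z.2) (μ.prod ν) :=
    (Lp.aestronglyMeasurable u).comp_fst.mul (Lp.aestronglyMeasurable v).comp_snd
  rw [memLp_two_iff_integrable_sq hm]
  have := (Lp.memLp u).integrable_sq.mul_prod (Lp.memLp v).integrable_sq
  simpa [mul_pow] using this

/-- The separable function `(x, y) ↦ u x * v y` in `L²` of the product. -/
def separable (u : RealL2 μ) (v : RealL2 ν) : RealL2 (μ.prod ν) :=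
  (memLp_mul_prod μ ν u v).toLp _

theorem separable_coeFn (u : RealL2 μ) (v : RealL2 ν) :
    separable μ ν u v =ᵐ[μ.prod ν] fun z => u z.1 * v z.2 :=
  (memLp_mul_prod μ ν u v).coeFn_toLp

theorem ae_fst {p : α → Prop} (h : ∀ᵐ x ∂μ, p x) : ∀ᵐ z ∂μ.prod ν, p z.1 :=
  Measure.quasiMeasurePreserving_fst.ae h

theorem ae_snd {p : β → Prop} (h : ∀ᵐ y ∂ν, p y) : ∀ᵐ z ∂μ.prod ν, p z.2 :=
  Measure.quasiMeasurePreserving_snd.ae h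

/-- `separable` as a bilinear map. -/
def separableₗ : RealL2 μ →ₗ[ℝ] RealL2 ν →ₗ[ℝ] RealL2 (μ.prod ν) :=
  LinearMap.mk₂ ℝ (separable μ ν)
    (fun u u' v => by
      ext1
      filter_upwards [separable_coeFn μ ν (u + u') v, separable_coeFn μ ν u v,
        separable_coeFn μ ν u' v, Lp.coeFn_add (separable μ ν u v) (separable μ ν u' v),
        ae_fst μ ν (Lp.coeFn_add u u')] with z h1 h2 h3 h4 h5
      simp only [h1, h4, Pi.add_apply, h2, h3, h5, add_mul])
    (fun c u v => by
      ext1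
      filter_upwards [separable_coeFn μ ν (c • u) v, separable_coeFn μ ν u v,
        Lp.coeFn_smul c (separable μ ν u v), ae_fst μ ν (Lp.coeFn_smul c u)] with z h1 h2 h3 h4
      simp only [h1, h3, Pi.smul_apply, h2, h4, smul_eq_mul, mul_assoc])
    (fun u v v' => by
      ext1
      filter_upwards [separable_coeFn μ ν u (v + v'), separable_coeFn μ ν u v,
        separable_coeFn μ ν u v', Lp.coeFn_add (separable μ ν u v) (separable μ ν u v'),
        ae_snd μ ν (Lp.coeFn_add v v')] with z h1 h2 h3 h4 h5
      simp only [h1, h4, Pi.add_apply, h2, h3, h5, mul_add])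
    (fun c u v => by
      ext1
      filter_upwards [separable_coeFn μ ν u (c • v), separable_coeFn μ ν u v,
        Lp.coeFn_smul c (separable μ ν u v), ae_snd μ ν (Lp.coeFn_smul c v)] with z h1 h2 h3 h4
      simp only [h1, h3, Pi.smul_apply, h2, h4, smul_eq_mul]
      ring)

theorem inner_separable (u u' : RealL2 μ) (v v' : RealL2 ν) :
    inner ℝ (separable μ ν u v) (separable μ ν u' v') = inner ℝ u u' * inner ℝ v v' := by
  simp only [L2.inner_def]
  rw [← integral_prod_mul]
  refine integral_congr_ae ?_
  filter_upwards [separable_coeFn μ ν u v, separable_coeFn μ ν u' v'] with z h1 h2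
  rw [h1, h2]
  simp only [RCLike.inner_apply, conj_trivial]
  ring

/-- The isometric linear map `L²(μ) ⊗ L²(ν) → L²(μ × ν)` that sends `u ⊗ v` to the function
`(x, y) ↦ u x * v y`. -/
def tensorToL2 : RealL2 μ ⊗[ℝ] RealL2 ν →ₗᵢ[ℝ] RealL2 (μ.prod ν) :=
  (TensorProduct.lift (separableₗ μ ν)).isometryOfInner fun x y => by
    induction x with
    | zero => simp
    | add x x' hx hx' => rw [map_add, inner_add_left, inner_add_left, hx, hx']
    | tmul u v =>
      induction y with
      | zero => simp
      | add y y' hy hy' => rw [map_add, inner_add_right, inner_add_right, hy, hy']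
      | tmul u' v' => exact inner_separable μ ν u u' v v'

end Product

/-- The mixed Sobolev space `H^{s₁}(Ω₁) ⊗ H^{s₂}(Ω₂)`: the Hilbert space tensor product, that is the
completion of the algebraic tensor product for the cross norm given by
`⟪u ⊗ v, u' ⊗ v'⟫ = ⟪u, u'⟫ ⟪v, v'⟫`. -/
abbrev SobolevMix (n₁ n₂ : ℕ) (s₁ s₂ : ℝ≥0) (Ω₁ : Set (Euc n₁)) (Ω₂ : Set (Euc n₂)) : Type :=
  Completion (SobolevOn n₁ s₁ Ω₁ ⊗[ℝ] SobolevOn n₂ s₂ Ω₂)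

/-- The canonical map of the mixed Sobolev space into `L²(Ω₁ × Ω₂)`: the continuous linear map that
sends `u ⊗ v` to the function `(x, y) ↦ u x * v y`. -/
def SobolevMix.toL2 (n₁ n₂ : ℕ) (s₁ s₂ : ℝ≥0) (Ω₁ : Set (Euc n₁)) (Ω₂ : Set (Euc n₂)) :
    SobolevMix n₁ n₂ s₁ s₂ Ω₁ Ω₂ →L[ℝ]
      RealL2 ((volume.restrict Ω₁).prod (volume.restrict Ω₂)) :=
  ((tensorToL2 (volume.restrict Ω₁) (volume.restrict Ω₂)).toContinuousLinearMap ∘L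
    TensorProduct.mapL (SobolevOn.toL2 n₁ s₁ Ω₁) (SobolevOn.toL2 n₂ s₂ Ω₂)).extend
      Completion.toComplL

theorem SobolevMix.toL2_tmul (n₁ n₂ : ℕ) (s₁ s₂ : ℝ≥0) (Ω₁ : Set (Euc n₁)) (Ω₂ : Set (Euc n₂))
    (u : SobolevOn n₁ s₁ Ω₁) (v : SobolevOn n₂ s₂ Ω₂) :
    SobolevMix.toL2 n₁ n₂ s₁ s₂ Ω₁ Ω₂ ((u ⊗ₜ[ℝ] v : SobolevOn n₁ s₁ Ω₁ ⊗[ℝ] SobolevOn n₂ s₂ Ω₂) :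
        SobolevMix n₁ n₂ s₁ s₂ Ω₁ Ω₂) =
      separable _ _ (SobolevOn.toL2 n₁ s₁ Ω₁ u) (SobolevOn.toL2 n₂ s₂ Ω₂ v) := by
  have h := ContinuousLinearMap.extend_eq
    ((tensorToL2 (volume.restrict Ω₁) (volume.restrict Ω₂)).toContinuousLinearMap ∘L
      TensorProduct.mapL (SobolevOn.toL2 n₁ s₁ Ω₁) (SobolevOn.toL2 n₂ s₂ Ω₂))
    (e := Completion.toComplL (𝕜 := ℝ)) Completion.denseRange_coe
    (Completion.isUniformInducing_coe _) (u ⊗ₜ[ℝ] v)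
  exact h

/-- The exponent `β = ((n₁/σ + σ n₂) / (n₁ n₂)) * min {s₁/σ, s₂ σ}`. -/
def rankExponent (n₁ n₂ : ℕ) (s₁ s₂ : ℝ≥0) (σ : ℝ) : ℝ :=
  ((n₁ : ℝ) / σ + σ * n₂) / ((n₁ : ℝ) * n₂) * min ((s₁ : ℝ) / σ) (s₂ * σ)

/-- `RankApprox Ω₁ Ω₂ f R ε`: some `f_R(x, y) = ∑_{r=1}^R g_r(x) h_r(y)` with `g_r ∈ L²(Ω₁)` and
`h_r ∈ L²(Ω₂)` satisfies `‖f - f_R‖ ≤ ε` in `L²(Ω₁ × Ω₂)`. -/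
def RankApprox {n₁ n₂ : ℕ} (Ω₁ : Set (Euc n₁)) (Ω₂ : Set (Euc n₂))
    (f : RealL2 ((volume.restrict Ω₁).prod (volume.restrict Ω₂))) (R : ℕ) (ε : ℝ) : Prop :=
  ∃ (g : Fin R → RealL2 (volume.restrict Ω₁)) (h : Fin R → RealL2 (volume.restrict Ω₂)),
    ‖f - ∑ r, separable (volume.restrict Ω₁) (volume.restrict Ω₂) (g r) (h r)‖ ≤ ε

end MixedSobolev
end

/-! A stronger bound holds: rank `R` gives error `C R^{-(s₁/n₁ + s₂/n₂)} ‖f‖` with no logarithm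
(`exists_rankApprox`). Since `β(σ) ≤ s₁/n₁ + s₂/n₂` for every `σ`, with equality at `σ = √(s₁/s₂)`,
this yields both cases of (a) and also (b); for `R ≥ 2` the factor `√(log R)` is bounded below by
`√(log 2)`.

Let `Aᵢ : H^{sᵢ}(Ωᵢ) → L²(Ωᵢ)` be the embeddings, `Pᵢ` orthogonal projections onto
finite-dimensional `Sᵢ`, and `Bᵢ = Aᵢ - PᵢAᵢ`. Then `A₁⊗A₂ - P₁A₁⊗A₂ - B₁⊗P₂A₂ = B₁⊗B₂`. The
subtracted terms yield `dim S₁ + dim S₂` separable summands, and the remainder has norm at most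
`‖B₁‖‖B₂‖` (`exists_sum_tmul_approx`).

It remains to find `S` of dimension at most `m` with `‖A - PA‖ ≤ C (m+1)^{-s/n}` on an arbitrary
bounded open set (`exists_finrank_approx`). By duality this asks that every `v ⟂ S`, extended by
zero, be small in the `H^{-s}` norm. Let `S` be spanned by sines and cosines with frequencies on a
fine grid in a cube, so that `v̂` vanishes on that grid. As `v` has bounded support, `v̂ = χ̂ * v̂`
for a cutoff `χ`, so `v̂` varies slowly. Hence the cube carries at most half of the `H^{-s}` mass
(`lintegral_weightedFourier_le`), and outside the cube the weight itself is small. -/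

noncomputable section

namespace MixedSobolev

open SchwartzMap
open scoped ContDiff

/-! ### The `L²` Fourier transform of integrable and compactly supported functions -/

/-- The Fourier transform on `L²` is symmetric for the bilinear pairing with Schwartz functions. -/
theorem integral_fourier_mul_Lp {n : ℕ} (z : Lp ℂ 2 (volume : Measure (Euc n))) (ψ : 𝓢(Euc n, ℂ)) :
    ∫ x, 𝓕 ψ x * z x = ∫ ξ, ψ ξ * (𝓕 z : Lp ℂ 2 (volume : Measure (Euc n))) ξ := by
  have h := congrArg (fun T => T ψ) (Lp.fourier_toTemperedDistribution_eq z)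
  simpa [TemperedDistribution.fourier_apply] using h

/-- On integrable functions the `L²` Fourier transform is given by the Fourier integral. -/
theorem fourier_Lp_ae_eq {n : ℕ} (z : Lp ℂ 2 (volume : Measure (Euc n))) (hz : Integrable z) :
    (𝓕 z : Lp ℂ 2 (volume : Measure (Euc n))) =ᵐ[volume] 𝓕 (z : Euc n → ℂ) := by
  have hc : Continuous (𝓕 (z : Euc n → ℂ)) :=
    VectorFourier.fourierIntegral_continuous Real.continuous_fourierChar
      (by exact continuous_inner) hz
  refine ae_eq_of_integral_contDiff_smul_eq ((Lp.memLp _).locallyIntegrable (by norm_num))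
    hc.locallyIntegrable fun g g_smooth g_cpt => ?_
  have hg₁ : HasCompactSupport (Complex.ofRealCLM ∘ g) := g_cpt.comp_left rfl
  have hg₂ : ContDiff ℝ ∞ (Complex.ofRealCLM ∘ g) := by fun_prop
  let ψ : 𝓢(Euc n, ℂ) := hg₁.toSchwartzMap hg₂
  have h1 := integral_fourier_mul_Lp z ψ
  have h2 := VectorFourier.integral_fourierIntegral_smul_eq_flip (μ := volume) (ν := volume)
    (L := innerₗ (Euc n)) (f := ψ) (g := (z : Euc n → ℂ)) Real.continuous_fourierChar
    (by exact continuous_inner) ψ.integrable hz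
  rw [flip_innerₗ] at h2
  calc ∫ x, g x • (𝓕 z : Lp ℂ 2 (volume : Measure (Euc n))) x
      = ∫ ξ, ψ ξ * (𝓕 z : Lp ℂ 2 (volume : Measure (Euc n))) ξ := by simp [ψ]
    _ = ∫ x, 𝓕 ψ x * z x := h1.symm
    _ = ∫ x, ψ x • 𝓕 (z : Euc n → ℂ) x := h2
    _ = _ := by simp [ψ]

/-- If `χ z = z` then the Fourier transform of `z` reproduces under convolution with that of
`χ`. -/
theorem fourier_eq_integral_fourier_sub {n : ℕ} (z : Lp ℂ 2 (volume : Measure (Euc n)))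
    {χ : Euc n → ℂ} (hχ : ContDiff ℝ ∞ χ) (hχc : HasCompactSupport χ)
    (h : ∀ᵐ x, χ x * z x = z x) (ξ : Euc n) :
    𝓕 (z : Euc n → ℂ) ξ =
      ∫ η, 𝓕 (hχc.toSchwartzMap hχ) (ξ - η) * (𝓕 z : Lp ℂ 2 (volume : Measure (Euc n))) η := by
  have hm₂ : ContDiff ℝ ∞ fun x : Euc n => (𝐞 (-inner ℝ x ξ) : ℂ) * χ x := by
    simp only [Real.fourierChar_apply]
    have : ContDiff ℝ ∞ fun x : Euc n => Complex.ofRealCLM (2 * Real.pi * -inner ℝ x ξ) :=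
      Complex.ofRealCLM.contDiff.comp
        (contDiff_const.mul (contDiff_id.inner ℝ contDiff_const).neg)
    exact ((this.mul contDiff_const).cexp).mul hχ
  have hm₁ : HasCompactSupport fun x : Euc n => (𝐞 (-inner ℝ x ξ) : ℂ) * χ x := hχc.mul_left
  -- The inverse transform of the modulated cutoff is `η ↦ χ̂(ξ - η)`, so pairing it with `𝓕 z` is
  -- the convolution at `ξ`.
  let m : 𝓢(Euc n, ℂ) := hm₁.toSchwartzMap hm₂
  have h1 := integral_fourier_mul_Lp z (𝓕⁻ m)
  rw [fourier_fourierInv_eq] at h1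
  have h3 : ∀ η, 𝓕⁻ m η = 𝓕 (hχc.toSchwartzMap hχ) (ξ - η) := by
    intro η
    rw [SchwartzMap.fourierInv_coe, SchwartzMap.fourier_coe, Real.fourierInv_eq, Real.fourier_eq]
    refine integral_congr_ae (.of_forall fun x => ?_)
    simp only [m, HasCompactSupport.toSchwartzMap_toFun, Circle.smul_def, smul_eq_mul]
    rw [← mul_assoc, ← Circle.coe_mul, ← AddChar.map_add_eq_mul]
    congr 3
    rw [inner_sub_right]; ring
  simp only [h3] at h1
  rw [← h1, Real.fourier_eq]
  refine integral_congr_ae ?_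
  filter_upwards [h] with x hx
  simp only [m, Circle.smul_def, smul_eq_mul]
  change _ = (𝐞 (-inner ℝ x ξ) : ℂ) * χ x * z x
  rw [mul_assoc, hx]

/-! ### Weighted convolution estimates -/

/-- Increments of a Schwartz function decay rapidly. -/
theorem schwartz_norm_sub_le {n : ℕ} (φ : 𝓢(Euc n, ℂ)) (k : ℕ) :
    ∃ B : ℝ, 0 ≤ B ∧ ∀ x y : Euc n, ‖x - y‖ ≤ 1 →
      ‖φ x - φ y‖ ≤ B * ‖x - y‖ * ((1 + ‖x‖) ^ k)⁻¹ := by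
  set B₀ : ℝ := 2 ^ k * (Finset.Iic (k, 1)).sup (fun m => SchwartzMap.seminorm ℝ m.1 m.2) φ
  have hB₀ : 0 ≤ B₀ := by positivity
  refine ⟨2 ^ k * B₀, by positivity, fun x y hxy => ?_⟩
  -- On the unit ball about `x`, `1 + ‖x‖ ≤ 2 (1 + ‖w‖)`: decay of the derivative at `w` becomes
  -- decay in `x` at the cost of `2 ^ k`, and the mean value inequality applies.
  have hd : ∀ w ∈ Metric.closedBall x 1, ‖fderiv ℝ φ w‖ ≤ 2 ^ k * B₀ * ((1 + ‖x‖) ^ k)⁻¹ := by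
    intro w hw
    have h1 : (1 + ‖w‖) ^ k * ‖iteratedFDeriv ℝ 1 φ w‖ ≤ B₀ :=
      one_add_le_sup_seminorm_apply (𝕜 := ℝ) (m := (k, 1)) le_rfl le_rfl φ w
    rw [norm_iteratedFDeriv_one] at h1
    have h2 : 1 + ‖x‖ ≤ 2 * (1 + ‖w‖) := by
      have h3 : ‖x‖ ≤ ‖w‖ + ‖w - x‖ := by
        have := norm_sub_le w (w - x); simpa using this
      rw [mem_closedBall_iff_norm] at hw
      linarith [norm_nonneg w]
    have h4 : (1 + ‖x‖) ^ k ≤ 2 ^ k * (1 + ‖w‖) ^ k := by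
      rw [← mul_pow]; gcongr
    rw [← div_eq_mul_inv, le_div_iff₀ (by positivity)]
    calc ‖fderiv ℝ φ w‖ * (1 + ‖x‖) ^ k
        ≤ ‖fderiv ℝ φ w‖ * (2 ^ k * (1 + ‖w‖) ^ k) := by gcongr
      _ = 2 ^ k * ((1 + ‖w‖) ^ k * ‖fderiv ℝ φ w‖) := by ring
      _ ≤ _ := by gcongr
  have h := (convex_closedBall x 1).norm_image_sub_le_of_norm_fderiv_le
    (fun w _ => φ.differentiableAt) hd (x := y) (y := x)
    (by rwa [mem_closedBall_iff_norm, norm_sub_rev]) (by simp)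
  calc _ ≤ _ := h
    _ = _ := by ring

/-- Peetre's inequality for the weight `(1 + ‖ξ‖²)^(-s/2)`. -/
theorem besselWeight_le_mul (n : ℕ) (s : ℝ≥0) (ξ η : Euc n) :
    besselWeight n s ξ ≤ 2 ^ ((s : ℝ) / 2) * (1 + ‖ξ - η‖) ^ (s : ℝ) * besselWeight n s η := by
  have h1 : 1 + ‖η‖ ^ 2 ≤ 2 * (1 + ‖ξ - η‖) ^ 2 * (1 + ‖ξ‖ ^ 2) := by
    have h3 : ‖η‖ ≤ ‖ξ‖ + ‖ξ - η‖ := by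
      have := norm_sub_le ξ (ξ - η); simpa using this
    have ha := norm_nonneg ξ
    have hb := norm_nonneg (ξ - η)
    have hc := norm_nonneg η
    set a := ‖ξ‖
    set b := ‖ξ - η‖
    have : ‖η‖ ^ 2 ≤ (a + b) ^ 2 := by gcongr
    nlinarith [sq_nonneg (a - b), mul_nonneg hb (sq_nonneg a), sq_nonneg (a * b)]
  have h2 := Real.rpow_le_rpow (z := (s : ℝ) / 2) (by positivity) h1 (by positivity)
  rw [Real.mul_rpow (by positivity) (by positivity), Real.mul_rpow (by positivity) (by positivity),
    ← Real.rpow_natCast (1 + ‖ξ - η‖) 2, ← Real.rpow_mul (by positivity)] at h2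
  have h3 : ((2 : ℕ) : ℝ) * ((s : ℝ) / 2) = s := by push_cast; ring
  rw [h3] at h2
  simp only [besselWeight, neg_div]
  rw [Real.rpow_neg (by positivity), Real.rpow_neg (by positivity), ← div_eq_mul_inv,
    le_div_iff₀ (by positivity), inv_mul_le_iff₀ (by positivity)]
  linarith

/-- Young's inequality for the convolution of an integrable and a square integrable function. -/
theorem lintegral_convolution_sq_le {n : ℕ} {k h : Euc n → ℝ≥0∞} (hk : Measurable k)
    (hh : AEMeasurable h) :
    ∫⁻ ξ, (∫⁻ η, k (ξ - η) * h η) ^ 2 ≤ (∫⁻ z, k z) ^ 2 * ∫⁻ η, h η ^ 2 := by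
  have hp : ∀ ξ, (∫⁻ η, k (ξ - η) * h η) ^ 2 ≤ (∫⁻ z, k z) * ∫⁻ η, k (ξ - η) * h η ^ 2 := by
    intro ξ
    have hm : Measurable fun η => k (ξ - η) := by fun_prop
    -- Cauchy–Schwarz with the kernel split as `k = k^{1/2} · k^{1/2}`.
    have h1 := ENNReal.lintegral_mul_le_Lp_mul_Lq volume Real.HolderConjugate.two_two
      (f := fun η => k (ξ - η) ^ (1 / 2 : ℝ)) (g := fun η => k (ξ - η) ^ (1 / 2 : ℝ) * h η)
      (by fun_prop) (by fun_prop)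
    have e1 : ∀ a : ℝ≥0∞, a ^ (1 / 2 : ℝ) * a ^ (1 / 2 : ℝ) = a := fun a => by
      rw [← ENNReal.rpow_add_of_nonneg _ _ (by norm_num) (by norm_num)]; norm_num
    have e2 : ∀ a : ℝ≥0∞, (a ^ (1 / 2 : ℝ)) ^ (2 : ℝ) = a := fun a => by
      rw [← ENNReal.rpow_mul]; norm_num
    simp only [Pi.mul_apply, ← mul_assoc, e1, ENNReal.mul_rpow_of_nonneg _ _ zero_le_two, e2] at h1
    calc (∫⁻ η, k (ξ - η) * h η) ^ 2
        ≤ ((∫⁻ η, k (ξ - η)) ^ (1 / 2 : ℝ) * (∫⁻ η, k (ξ - η) * h η ^ (2 : ℝ)) ^ (1 / 2 : ℝ)) ^ 2 :=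
          pow_le_pow_left' h1 2
      _ = (∫⁻ η, k (ξ - η)) * ∫⁻ η, k (ξ - η) * h η ^ (2 : ℝ) := by
          rw [mul_pow, ← ENNReal.rpow_natCast, ← ENNReal.rpow_natCast]
          simp only [Nat.cast_ofNat, e2]
      _ = _ := by
          rw [lintegral_sub_left_eq_self k ξ]
          simp only [ENNReal.rpow_two]
  calc ∫⁻ ξ, (∫⁻ η, k (ξ - η) * h η) ^ 2
      ≤ ∫⁻ ξ, (∫⁻ z, k z) * ∫⁻ η, k (ξ - η) * h η ^ 2 := lintegral_mono hp
    _ = (∫⁻ z, k z) * ∫⁻ η, ∫⁻ ξ, k (ξ - η) * h η ^ 2 := by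
        have hm : AEMeasurable (fun p : Euc n × Euc n => k (p.1 - p.2) * h p.2 ^ 2)
            (volume.prod volume) :=
          (hk.comp (measurable_fst.sub measurable_snd)).aemeasurable.mul
            (hh.comp_snd.pow_const 2)
        rw [lintegral_const_mul'' _ hm.lintegral_prod_right', lintegral_lintegral_swap hm]
    _ = (∫⁻ z, k z) * ∫⁻ η, (∫⁻ z, k z) * h η ^ 2 := by
        congr 1
        refine lintegral_congr fun η => ?_
        rw [lintegral_mul_const _ (by fun_prop), lintegral_sub_right_eq_self k η]
    _ = _ := by
        rw [lintegral_const_mul'' _ (hh.pow_const 2), sq, mul_assoc]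

/-- The weighted modulus of the Fourier transform of a square integrable function. -/
def weightedFourier {n : ℕ} (s : ℝ≥0) (z : Lp ℂ 2 (volume : Measure (Euc n))) (ξ : Euc n) : ℝ≥0∞ :=
  ENNReal.ofReal (besselWeight n s ξ) * ‖(𝓕 z : Lp ℂ 2 (volume : Measure (Euc n))) ξ‖ₑ

theorem measurable_besselWeight (n : ℕ) (s : ℝ≥0) : Measurable (besselWeight n s) := by
  unfold besselWeight
  fun_prop

theorem besselWeight_nonneg (n : ℕ) (s : ℝ≥0) (ξ : Euc n) : 0 ≤ besselWeight n s ξ := by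
  unfold besselWeight; positivity

theorem besselWeight_le_one (n : ℕ) (s : ℝ≥0) (ξ : Euc n) : besselWeight n s ξ ≤ 1 := by
  refine Real.rpow_le_one_of_one_le_of_nonpos (by nlinarith [sq_nonneg ‖ξ‖]) ?_
  have : (0 : ℝ) ≤ s := s.2
  linarith

theorem aemeasurable_weightedFourier {n : ℕ} (s : ℝ≥0) (z : Lp ℂ 2 (volume : Measure (Euc n))) :
    AEMeasurable (weightedFourier s z) :=
  (measurable_besselWeight n s).ennreal_ofReal.aemeasurable.mul
    (Lp.aestronglyMeasurable _).enorm

theorem lintegral_enorm_sq_Lp {α : Type*} [MeasurableSpace α] {μ : Measure α} (z : Lp ℂ 2 μ) :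
    ∫⁻ x, ‖z x‖ₑ ^ 2 ∂μ = ENNReal.ofReal (‖z‖ ^ 2) := by
  rw [Lp.norm_def, ENNReal.ofReal_pow ENNReal.toReal_nonneg, ENNReal.ofReal_toReal (Lp.eLpNorm_ne_top z),
    eLpNorm_eq_lintegral_rpow_enorm_toReal (by norm_num) (by norm_num), ← ENNReal.rpow_natCast,
    ← ENNReal.rpow_mul]
  norm_num

/-- Weighted form of the bound on increments of a convolution. -/
theorem besselWeight_mul_lintegral_le {n N : ℕ} (s : ℝ≥0) {φ F : Euc n → ℂ} {B δ : ℝ} (hB : 0 ≤ B)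
    (hδ : 0 ≤ δ) (hδ1 : δ ≤ 1)
    (hφ : ∀ x y : Euc n, ‖x - y‖ ≤ 1 → ‖φ x - φ y‖ ≤ B * ‖x - y‖ * ((1 + ‖x‖) ^ N)⁻¹)
    {ξ ξ' : Euc n} (hd : ‖ξ - ξ'‖ ≤ δ) :
    ENNReal.ofReal (besselWeight n s ξ) * ∫⁻ η, ‖(φ (ξ - η) - φ (ξ' - η)) * F η‖ₑ ≤
      ENNReal.ofReal δ * ∫⁻ η,
        ENNReal.ofReal (B * 2 ^ ((s : ℝ) / 2) * (1 + ‖ξ - η‖) ^ (-((N : ℝ) - s))) *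
          (ENNReal.ofReal (besselWeight n s η) * ‖F η‖ₑ) := by
  rw [← lintegral_const_mul' _ _ ENNReal.ofReal_ne_top,
    ← lintegral_const_mul' _ _ ENNReal.ofReal_ne_top]
  refine lintegral_mono fun η => ?_
  have h4 := hφ (ξ - η) (ξ' - η) (by simpa using hd.trans hδ1)
  rw [sub_sub_sub_cancel_right] at h4
  have h5 := besselWeight_le_mul n s ξ η
  -- The growth `(1 + ‖ξ - η‖)^s` from Peetre's inequality is absorbed by the decay of order `N`.
  have e : (1 + ‖ξ - η‖) ^ (-((N : ℝ) - s)) =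
      (1 + ‖ξ - η‖) ^ (s : ℝ) * ((1 + ‖ξ - η‖) ^ N)⁻¹ := by
    rw [neg_sub, Real.rpow_sub (by positivity), Real.rpow_natCast, div_eq_mul_inv]
  have hw := besselWeight_nonneg n s η
  have hreal : besselWeight n s ξ * ‖φ (ξ - η) - φ (ξ' - η)‖ ≤
      δ * (B * 2 ^ ((s : ℝ) / 2) * (1 + ‖ξ - η‖) ^ (-((N : ℝ) - s))) * besselWeight n s η := by
    calc besselWeight n s ξ * ‖φ (ξ - η) - φ (ξ' - η)‖
        ≤ (2 ^ ((s : ℝ) / 2) * (1 + ‖ξ - η‖) ^ (s : ℝ) * besselWeight n s η) *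
          (B * δ * ((1 + ‖ξ - η‖) ^ N)⁻¹) := by
          refine mul_le_mul h5 (h4.trans ?_) (norm_nonneg _) (by positivity)
          gcongr
      _ = _ := by rw [e]; ring
  rw [enorm_mul, ← mul_assoc, ← mul_assoc, ← mul_assoc, ← ofReal_norm (φ _ - φ _),
    ← ENNReal.ofReal_mul (besselWeight_nonneg _ _ _), ← ENNReal.ofReal_mul hδ,
    ← ENNReal.ofReal_mul (by positivity)]
  exact mul_le_mul_left (ENNReal.ofReal_le_ofReal hreal) _

/-- Finiteness is what allows half of the total mass to be cancelled in
`lintegral_weightedFourier_le`. -/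
theorem lintegral_weightedFourier_sq_ne_top {n : ℕ} (s : ℝ≥0)
    (z : Lp ℂ 2 (volume : Measure (Euc n))) : ∫⁻ ξ, weightedFourier s z ξ ^ 2 ≠ ⊤ := by
  refine ne_top_of_le_ne_top
    (b := ∫⁻ ξ, ‖(𝓕 z : Lp ℂ 2 (volume : Measure (Euc n))) ξ‖ₑ ^ 2) ?_
    (lintegral_mono fun ξ => pow_le_pow_left' ?_ 2)
  · rw [lintegral_enorm_sq_Lp]; exact ENNReal.ofReal_ne_top
  · exact mul_le_of_le_one_left' (ENNReal.ofReal_le_one.2 (besselWeight_le_one n s ξ))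

/-! ### Mass of the transform near its zeros -/

/-- A function supported where the cutoff `χ` is one, and whose Fourier transform has zeros near
every point of `D`, has its weighted Fourier transform controlled off `D`. -/
theorem lintegral_weightedFourier_le {n : ℕ} (s : ℝ≥0)
    {χ : Euc n → ℂ} (hχ : ContDiff ℝ ∞ χ) (hχc : HasCompactSupport χ) :
    ∃ δ : ℝ, 0 < δ ∧ ∀ z : Lp ℂ 2 (volume : Measure (Euc n)), Integrable z →
      (∀ᵐ x, χ x * z x = z x) → ∀ D : Set (Euc n), MeasurableSet D →
      (∀ ξ ∈ D, ∃ ξ', ‖ξ - ξ'‖ ≤ δ ∧ 𝓕 (z : Euc n → ℂ) ξ' = 0) →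
      ∫⁻ ξ, weightedFourier s z ξ ^ 2 ≤ 2 * ∫⁻ ξ in Dᶜ, weightedFourier s z ξ ^ 2 := by
  set φ : 𝓢(Euc n, ℂ) := 𝓕 (hχc.toSchwartzMap hχ)
  -- `N - s > n` makes the kernel `k` integrable.
  obtain ⟨N, hN⟩ := exists_nat_gt ((s : ℝ) + n)
  obtain ⟨B, hB, hφ⟩ := schwartz_norm_sub_le φ N
  set c : ℝ := B * 2 ^ ((s : ℝ) / 2)
  have hc : 0 ≤ c := by positivity
  set k : Euc n → ℝ := fun x => c * (1 + ‖x‖) ^ (-((N : ℝ) - s))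
  have hk : Measurable k := by fun_prop
  have hk0 : ∀ x, 0 ≤ k x := fun x => by positivity
  have hki : Integrable k :=
    (integrable_one_add_norm (by rw [finrank_euclideanSpace_fin]; linarith)).const_mul c
  set κ : ℝ := ∫ x, k x
  have hκ0 : 0 ≤ κ := integral_nonneg hk0
  have hκ : ∫⁻ x, ENNReal.ofReal (k x) = ENNReal.ofReal κ :=
    (ofReal_integral_eq_lintegral_ofReal hki (.of_forall hk0)).symm
  -- The bound `1` is the range in which `hφ` holds; the other bound gives `δ * κ ≤ 1 / 2`, with `κ
  -- + 1` avoiding division by zero.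
  refine ⟨min 1 (1 / (2 * (κ + 1))), by positivity, fun z hz hχz D hD hzero => ?_⟩
  set δ : ℝ := min 1 (1 / (2 * (κ + 1)))
  have hδ0 : 0 < δ := by positivity
  have hδκ : δ * κ ≤ 1 / 2 := by
    calc δ * κ ≤ 1 / (2 * (κ + 1)) * (κ + 1) := by gcongr; exacts [min_le_right _ _, by linarith]
      _ = 1 / 2 := by field_simp
  set F : Lp ℂ 2 (volume : Measure (Euc n)) := 𝓕 z
  have hφm : ∀ ξ, MemLp (fun η => φ (ξ - η)) 2 volume := fun ξ =>
    (φ.memLp 2 volume).comp_measurePreserving (Measure.measurePreserving_sub_left volume ξ)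
  have hint : ∀ ξ, Integrable fun η => φ (ξ - η) * F η := fun ξ =>
    (hφm ξ).integrable_mul (Lp.memLp F)
  have hkey : ∀ᵐ ξ, ξ ∈ D → weightedFourier s z ξ ≤
      ENNReal.ofReal δ * ∫⁻ η, ENNReal.ofReal (k (ξ - η)) * weightedFourier s z η := by
    filter_upwards [fourier_Lp_ae_eq z hz] with ξ hξ hξD
    obtain ⟨ξ', hd, h0⟩ := hzero ξ hξD
    -- Subtracting the vanishing value at `ξ'` replaces the kernel by its increment, which is of
    -- size `δ`.
    have h1 : F ξ = ∫ η, (φ (ξ - η) - φ (ξ' - η)) * F η := by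
      have h2 := fourier_eq_integral_fourier_sub z hχ hχc hχz ξ
      have h3 := fourier_eq_integral_fourier_sub z hχ hχc hχz ξ'
      rw [h0] at h3
      calc F ξ = (∫ η, φ (ξ - η) * F η) - ∫ η, φ (ξ' - η) * F η := by
            rw [← h2, ← h3, sub_zero]; exact hξ
        _ = _ := by
            rw [← integral_sub (hint ξ) (hint ξ')]
            simp only [sub_mul]
    have hF : F = (𝓕 z : Lp ℂ 2 (volume : Measure (Euc n))) := rfl
    unfold weightedFourier
    rw [← hF, h1]
    calc ENNReal.ofReal (besselWeight n s ξ) * ‖∫ η, (φ (ξ - η) - φ (ξ' - η)) * F η‖ₑ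
        ≤ ENNReal.ofReal (besselWeight n s ξ) * ∫⁻ η, ‖(φ (ξ - η) - φ (ξ' - η)) * F η‖ₑ :=
          mul_le_mul_right (enorm_integral_le_lintegral_enorm _) _
      _ ≤ _ := besselWeight_mul_lintegral_le s hB hδ0.le (min_le_left _ _) hφ hd
  set I := ∫⁻ ξ, weightedFourier s z ξ ^ 2
  have hI : I ≠ ⊤ := lintegral_weightedFourier_sq_ne_top s z
  -- Young's inequality gives the factor `(δ κ)² ≤ 1 / 4`, more than enough.
  have hDI : ∫⁻ ξ in D, weightedFourier s z ξ ^ 2 ≤ I / 2 := by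
    calc ∫⁻ ξ in D, weightedFourier s z ξ ^ 2
        ≤ ∫⁻ ξ in D, (ENNReal.ofReal δ *
            ∫⁻ η, ENNReal.ofReal (k (ξ - η)) * weightedFourier s z η) ^ 2 := by
          refine setLIntegral_mono_ae' hD ?_
          filter_upwards [hkey] with ξ hξ hξD
          exact pow_le_pow_left' (hξ hξD) 2
      _ ≤ ∫⁻ ξ, (ENNReal.ofReal δ *
            ∫⁻ η, ENNReal.ofReal (k (ξ - η)) * weightedFourier s z η) ^ 2 :=
          setLIntegral_le_lintegral _ _
      _ = ENNReal.ofReal δ ^ 2 *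
            ∫⁻ ξ, (∫⁻ η, ENNReal.ofReal (k (ξ - η)) * weightedFourier s z η) ^ 2 := by
          simp only [mul_pow]
          exact lintegral_const_mul' _ _ (by finiteness)
      _ ≤ ENNReal.ofReal δ ^ 2 * (ENNReal.ofReal κ ^ 2 * I) := by
          gcongr
          rw [← hκ]
          exact lintegral_convolution_sq_le hk.ennreal_ofReal (aemeasurable_weightedFourier s z)
      _ = ENNReal.ofReal ((δ * κ) ^ 2) * I := by
          rw [← mul_assoc, ← mul_pow, ← ENNReal.ofReal_mul hδ0.le, ENNReal.ofReal_pow (by positivity)]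
      _ ≤ ENNReal.ofReal (1 / 2) * I := by
          gcongr
          have : 0 ≤ δ * κ := by positivity
          nlinarith
      _ = I / 2 := by
          rw [ENNReal.ofReal_div_of_pos two_pos, ENNReal.div_eq_inv_mul, ENNReal.div_eq_inv_mul]
          simp
  have hsplit : I = (∫⁻ ξ in D, weightedFourier s z ξ ^ 2) +
      ∫⁻ ξ in Dᶜ, weightedFourier s z ξ ^ 2 := (lintegral_add_compl _ hD).symm
  have h2 : I / 2 + I / 2 ≤ I / 2 + ∫⁻ ξ in Dᶜ, weightedFourier s z ξ ^ 2 := by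
    rw [ENNReal.add_halves]
    calc I = _ := hsplit
      _ ≤ _ := by gcongr
  have h3 := (ENNReal.add_le_add_iff_left (by finiteness)).1 h2
  calc I = 2 * (I / 2) := by rw [ENNReal.mul_div_cancel (by norm_num) (by norm_num)]
    _ ≤ _ := by gcongr

/-! ### Extension by zero and duality -/

/-- Extension by zero of square integrable functions on `Ω`. -/
def zeroExtension {n : ℕ} {Ω : Set (Euc n)} (hΩ : MeasurableSet Ω)
    (v : RealL2 (volume.restrict Ω)) : RealL2 (volume : Measure (Euc n)) :=
  ((memLp_indicator_iff_restrict hΩ).2 (Lp.memLp v)).toLp (Ω.indicator v)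

theorem zeroExtension_coeFn {n : ℕ} {Ω : Set (Euc n)} (hΩ : MeasurableSet Ω)
    (v : RealL2 (volume.restrict Ω)) : zeroExtension hΩ v =ᵐ[volume] Ω.indicator v :=
  MemLp.coeFn_toLp _

theorem norm_zeroExtension {n : ℕ} {Ω : Set (Euc n)} (hΩ : MeasurableSet Ω)
    (v : RealL2 (volume.restrict Ω)) : ‖zeroExtension hΩ v‖ = ‖v‖ := by
  rw [zeroExtension, Lp.norm_toLp, eLpNorm_indicator_eq_eLpNorm_restrict hΩ, Lp.norm_def]

theorem inner_zeroExtension {n : ℕ} {Ω : Set (Euc n)} (hΩ : MeasurableSet Ω)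
    (v : RealL2 (volume.restrict Ω)) (u : RealL2 (volume : Measure (Euc n))) :
    inner ℝ v (LpToLpRestrictCLM (Euc n) ℝ ℝ volume 2 Ω u) = inner ℝ (zeroExtension hΩ v) u := by
  rw [L2.inner_def, L2.inner_def]
  calc _ = ∫ x in Ω, inner ℝ (v x) (u x) := by
        refine integral_congr_ae ?_
        filter_upwards [LpToLpRestrictCLM_coeFn ℝ Ω u] with x hx
        rw [hx]
    _ = ∫ x, Ω.indicator (fun x => inner ℝ (v x) (u x)) x := (integral_indicator hΩ).symm
    _ = _ := by
        refine integral_congr_ae ?_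
        filter_upwards [zeroExtension_coeFn hΩ v] with x hx
        rw [hx]
        by_cases h : x ∈ Ω <;> simp [h]

/-- The complex-valued extension by zero of a real-valued function on `Ω`. -/
def complexExtension {n : ℕ} {Ω : Set (Euc n)} (hΩ : MeasurableSet Ω)
    (v : RealL2 (volume.restrict Ω)) : Lp ℂ 2 (volume : Measure (Euc n)) :=
  Complex.ofRealCLM.compLp (zeroExtension hΩ v)

theorem realFourier_zeroExtension {n : ℕ} {Ω : Set (Euc n)} (hΩ : MeasurableSet Ω)
    (v : RealL2 (volume.restrict Ω)) :
    realFourier n (zeroExtension hΩ v) = 𝓕 (complexExtension hΩ v) := rfl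

theorem norm_fourier_complexExtension {n : ℕ} {Ω : Set (Euc n)} (hΩ : MeasurableSet Ω)
    (v : RealL2 (volume.restrict Ω)) :
    ‖(𝓕 (complexExtension hΩ v) : Lp ℂ 2 (volume : Measure (Euc n)))‖ = ‖v‖ := by
  rw [← realFourier_zeroExtension, LinearIsometry.norm_map, norm_zeroExtension]

theorem complexExtension_coeFn {n : ℕ} {Ω : Set (Euc n)} (hΩ : MeasurableSet Ω)
    (v : RealL2 (volume.restrict Ω)) :
    complexExtension hΩ v =ᵐ[volume] Ω.indicator fun x => (v x : ℂ) := by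
  filter_upwards [Complex.ofRealCLM.coeFn_compLp (zeroExtension hΩ v), zeroExtension_coeFn hΩ v]
    with x h1 h2
  rw [complexExtension, h1, h2]
  by_cases h : x ∈ Ω <;> simp [h]

theorem integrable_coe_of_isFiniteMeasure {α : Type*} [MeasurableSpace α] {μ : Measure α}
    [IsFiniteMeasure μ] (v : RealL2 μ) : Integrable (fun x => (v x : ℂ)) μ :=
  ((Lp.memLp v).integrable (by norm_num)).ofReal

theorem inner_besselMul {n : ℕ} (s : ℝ≥0) (u w : Lp ℂ 2 (volume : Measure (Euc n))) :
    inner ℝ u (besselMul n s w) = inner ℝ (besselMul n s u) w := by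
  rw [L2.inner_def, L2.inner_def]
  refine integral_congr_ae ?_
  filter_upwards [besselMul_coeFn n s u, besselMul_coeFn n s w] with ξ h1 h2
  rw [h1, h2, real_inner_smul_left, real_inner_smul_right]

/-- The pairing of a function on `Ω` with the restriction of a Sobolev function is controlled by
the dual Sobolev norm. -/
theorem abs_inner_restrictL2_le {n : ℕ} (s : ℝ≥0) {Ω : Set (Euc n)} (hΩ : MeasurableSet Ω)
    (v : RealL2 (volume.restrict Ω)) (w : SobolevRn n s) :
    |inner ℝ v (restrictL2 n s Ω w)| ≤
      ‖besselMul n s (𝓕 (complexExtension hΩ v) : Lp ℂ 2 (volume : Measure (Euc n)))‖ * ‖w‖ := by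
  -- Extension by zero is adjoint to restriction; after Plancherel the real weight moves from `w` to
  -- the transform of `v`.
  have h : inner ℝ v (restrictL2 n s Ω w) = inner ℝ
      (besselMul n s (𝓕 (complexExtension hΩ v) : Lp ℂ 2 (volume : Measure (Euc n))))
      (w : Lp ℂ 2 (volume : Measure (Euc n))) := by
    rw [restrictL2, ContinuousLinearMap.comp_apply, inner_zeroExtension hΩ,
      ← (realFourier n).inner_map_map, SobolevRn.realFourier_toL2, inner_besselMul]
    rfl
  rw [h]
  exact abs_real_inner_le_norm _ _

/-- Connects the dual norm in `abs_inner_restrictL2_le` with the integral in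
`lintegral_weightedFourier_le`. -/
theorem ofReal_norm_besselMul_sq {n : ℕ} (s : ℝ≥0) (z : Lp ℂ 2 (volume : Measure (Euc n))) :
    ENNReal.ofReal (‖besselMul n s (𝓕 z : Lp ℂ 2 (volume : Measure (Euc n)))‖ ^ 2) =
      ∫⁻ ξ, weightedFourier s z ξ ^ 2 := by
  rw [← lintegral_enorm_sq_Lp]
  refine lintegral_congr_ae ?_
  filter_upwards [besselMul_coeFn n s (𝓕 z : Lp ℂ 2 (volume : Measure (Euc n)))] with ξ h
  rw [h, enorm_smul, weightedFourier, Real.enorm_of_nonneg (besselWeight_nonneg n s ξ)]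

/-! ### Trigonometric subspaces and zeros on a grid -/

section Trigonometric

variable {n : ℕ} (Ω : Set (Euc n)) [IsFiniteMeasure ((volume : Measure (Euc n)).restrict Ω)]

theorem memLp_cos (ξ : Euc n) :
    MemLp (fun x : Euc n => Real.cos (2 * Real.pi * inner ℝ x ξ)) 2 (volume.restrict Ω) :=
  MemLp.of_bound (by fun_prop) 1 (.of_forall fun x => by simpa using Real.abs_cos_le_one _)

theorem memLp_sin (ξ : Euc n) :
    MemLp (fun x : Euc n => Real.sin (2 * Real.pi * inner ℝ x ξ)) 2 (volume.restrict Ω) :=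
  MemLp.of_bound (by fun_prop) 1 (.of_forall fun x => by simpa using Real.abs_sin_le_one _)

/-- The function `x ↦ cos (2 π x · ξ)` on `Ω`. -/
def cosL2 (ξ : Euc n) : RealL2 (volume.restrict Ω) := (memLp_cos Ω ξ).toLp _

/-- The function `x ↦ sin (2 π x · ξ)` on `Ω`. -/
def sinL2 (ξ : Euc n) : RealL2 (volume.restrict Ω) := (memLp_sin Ω ξ).toLp _

variable {Ω}

theorem integrable_complexExtension (hΩ : MeasurableSet Ω) (v : RealL2 (volume.restrict Ω)) :
    Integrable (complexExtension hΩ v) := by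
  rw [integrable_congr (complexExtension_coeFn hΩ v), integrable_indicator_iff hΩ]
  exact integrable_coe_of_isFiniteMeasure v

/-- As `v` is real, the two pairings are, up to sign, the real and imaginary parts of its Fourier
integral at `ξ`. -/
theorem fourier_complexExtension_eq_zero (hΩ : MeasurableSet Ω) {v : RealL2 (volume.restrict Ω)}
    {ξ : Euc n} (hc : inner ℝ (cosL2 Ω ξ) v = 0) (hs : inner ℝ (sinL2 Ω ξ) v = 0) :
    𝓕 (complexExtension hΩ v : Euc n → ℂ) ξ = 0 := by
  have hc' : ∫ x in Ω, Real.cos (2 * Real.pi * inner ℝ x ξ) * v x = 0 := by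
    rw [← hc, L2.inner_def]
    refine integral_congr_ae ?_
    filter_upwards [(memLp_cos Ω ξ).coeFn_toLp] with x hx
    rw [cosL2, hx]
    simp [mul_comm]
  have hs' : ∫ x in Ω, Real.sin (2 * Real.pi * inner ℝ x ξ) * v x = 0 := by
    rw [← hs, L2.inner_def]
    refine integral_congr_ae ?_
    filter_upwards [(memLp_sin Ω ξ).coeFn_toLp] with x hx
    rw [sinL2, hx]
    simp [mul_comm]
  have hic : Integrable (fun x => ((Real.cos (2 * Real.pi * inner ℝ x ξ) * v x : ℝ) : ℂ))
      (volume.restrict Ω) := ((memLp_cos Ω ξ).integrable_mul (Lp.memLp v)).ofReal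
  have his : Integrable (fun x => ((Real.sin (2 * Real.pi * inner ℝ x ξ) * v x : ℝ) : ℂ))
      (volume.restrict Ω) := ((memLp_sin Ω ξ).integrable_mul (Lp.memLp v)).ofReal
  rw [Real.fourier_eq]
  calc ∫ x, 𝐞 (-inner ℝ x ξ) • complexExtension hΩ v x
      = ∫ x, Ω.indicator (fun x => ((Real.cos (2 * Real.pi * inner ℝ x ξ) * v x : ℝ) : ℂ) -
          Complex.I * ((Real.sin (2 * Real.pi * inner ℝ x ξ) * v x : ℝ) : ℂ)) x := by
        refine integral_congr_ae ?_
        filter_upwards [complexExtension_coeFn hΩ v] with x hx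
        rw [hx]
        by_cases h : x ∈ Ω
        · simp only [h, Set.indicator_of_mem, Circle.smul_def, Real.fourierChar_apply, smul_eq_mul]
          rw [Complex.exp_mul_I, ← Complex.ofReal_cos, ← Complex.ofReal_sin, mul_neg, Real.cos_neg,
            Real.sin_neg]
          push_cast
          ring
        · simp [h]
    _ = (∫ x in Ω, ((Real.cos (2 * Real.pi * inner ℝ x ξ) * v x : ℝ) : ℂ)) -
          Complex.I * ∫ x in Ω, ((Real.sin (2 * Real.pi * inner ℝ x ξ) * v x : ℝ) : ℂ) := by
        rw [integral_indicator hΩ, integral_sub hic (his.const_mul _), integral_const_mul]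
    _ = 0 := by
        rw [integral_complex_ofReal, integral_complex_ofReal, hc', hs']
        simp

/-- The span of the cosines and sines with frequencies `δ k`, where `k` ranges over the integer
vectors with entries in `[-J, J)`. -/
def trigSpan (Ω : Set (Euc n)) [IsFiniteMeasure ((volume : Measure (Euc n)).restrict Ω)]
    (δ : ℝ) (J : ℕ) : Submodule ℝ (RealL2 ((volume : Measure (Euc n)).restrict Ω)) :=
  Submodule.span ℝ (Set.range (Sum.elim
    (fun k : Fintype.piFinset fun _ : Fin n => Finset.Ico (-J : ℤ) J =>
      cosL2 Ω (WithLp.toLp 2 fun i => δ * (k.1 i : ℝ)))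
    (fun k : Fintype.piFinset fun _ : Fin n => Finset.Ico (-J : ℤ) J =>
      sinL2 Ω (WithLp.toLp 2 fun i => δ * (k.1 i : ℝ)))))

instance trigSpan.finiteDimensional (δ : ℝ) (J : ℕ) : FiniteDimensional ℝ (trigSpan Ω δ J) :=
  FiniteDimensional.span_of_finite ℝ (Set.finite_range _)

theorem finrank_trigSpan_le (hn : 0 < n) (δ : ℝ) (J : ℕ) :
    Module.finrank ℝ (trigSpan Ω δ J) ≤ (4 * J) ^ n := by
  refine (finrank_range_le_card _).trans ?_
  rw [Fintype.card_sum, Fintype.card_coe, Fintype.card_piFinset]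
  have h : (((J : ℤ)) - (-J : ℤ)).toNat = 2 * J := by omega
  simp only [Int.card_Ico, h, Finset.prod_const, Finset.card_univ, Fintype.card_fin]
  calc (2 * J) ^ n + (2 * J) ^ n = 2 * (2 * J) ^ n := by ring
    _ ≤ 2 ^ n * (2 * J) ^ n := by
        gcongr
        exact Nat.le_self_pow hn.ne' 2
    _ = (4 * J) ^ n := by rw [← mul_pow]; ring

/-- Rounding each coordinate of `ξ` down to the grid of step `δ / n` moves `ξ` by at most `√n · δ /
n ≤ δ`. The half-open cube matches the floor function, so the indices stay in `[-J, J)`. -/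
theorem exists_zero_near (hn : 0 < n) (hΩ : MeasurableSet Ω) {δ : ℝ} (hδ : 0 < δ) {J : ℕ}
    {v : RealL2 (volume.restrict Ω)} (hv : v ∈ (trigSpan Ω (δ / n) J)ᗮ) {ξ : Euc n}
    (hξ : ∀ i, -(δ / n * J) ≤ ξ i ∧ ξ i < δ / n * J) :
    ∃ ξ', ‖ξ - ξ'‖ ≤ δ ∧ 𝓕 (complexExtension hΩ v : Euc n → ℂ) ξ' = 0 := by
  have hn' : (0 : ℝ) < n := by exact_mod_cast hn
  set ε := δ / n with hε
  have hε0 : 0 < ε := by positivity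
  have hk : (fun i => ⌊ξ i / ε⌋) ∈ Fintype.piFinset fun _ : Fin n => Finset.Ico (-J : ℤ) J := by
    rw [Fintype.mem_piFinset]
    intro i
    rw [Finset.mem_Ico, Int.le_floor, Int.floor_lt, le_div_iff₀ hε0, div_lt_iff₀ hε0]
    have := hξ i
    push_cast
    constructor <;> linarith
  refine ⟨WithLp.toLp 2 fun i => ε * (⌊ξ i / ε⌋ : ℝ), ?_, ?_⟩
  · refine abs_le_of_sq_le_sq' ?_ hδ.le |>.2
    rw [EuclideanSpace.real_norm_sq_eq]
    calc ∑ i, (ξ - WithLp.toLp 2 fun i => ε * (⌊ξ i / ε⌋ : ℝ)).ofLp i ^ 2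
        ≤ ∑ _i : Fin n, ε ^ 2 := by
          refine Finset.sum_le_sum fun i _ => ?_
          have h1 := Int.floor_le (ξ i / ε)
          have h2 := (Int.lt_floor_add_one (ξ i / ε)).le
          rw [le_div_iff₀ hε0] at h1
          rw [div_le_iff₀ hε0] at h2
          simp only [PiLp.sub_apply]
          refine pow_le_pow_left₀ ?_ ?_ 2 <;> linarith
      _ = n * ε ^ 2 := by simp
      _ ≤ n * (n * ε ^ 2) := by
          gcongr
          exact le_mul_of_one_le_left (by positivity) (by exact_mod_cast hn)
      _ = δ ^ 2 := by rw [hε]; field_simp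
  · refine fourier_complexExtension_eq_zero hΩ ?_ ?_
    · exact (Submodule.mem_orthogonal _ _).1 hv _
        (Submodule.subset_span ⟨Sum.inl ⟨_, hk⟩, rfl⟩)
    · exact (Submodule.mem_orthogonal _ _).1 hv _
        (Submodule.subset_span ⟨Sum.inr ⟨_, hk⟩, rfl⟩)

end Trigonometric

/-! ### Finite-rank approximation of the Sobolev embedding -/

/-- Decay of the weight outside a cube. -/
theorem besselWeight_le_of_le_norm {n : ℕ} (s : ℝ≥0) {ε : ℝ} (hε : 0 < ε) (J : ℕ) {ξ : Euc n}
    (hξ : ε * J ≤ ‖ξ‖) :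
    besselWeight n s ξ ≤ (min 1 (ε ^ 2) / 2) ^ (-(s : ℝ) / 2) * ((J : ℝ) + 1) ^ (-(s : ℝ)) := by
  set c := min 1 (ε ^ 2) / 2 with hc
  have hc0 : 0 < c := by positivity
  -- The halving in `c` pays for `(J + 1)² ≤ 2 (1 + J²)`; `J + 1` keeps the bound meaningful at `J =
  -- 0`.
  have h1 : c * ((J : ℝ) + 1) ^ 2 ≤ 1 + ‖ξ‖ ^ 2 := by
    have h2 : (ε * J) ^ 2 ≤ ‖ξ‖ ^ 2 := by gcongr
    have h3 : 2 * c ≤ 1 := by rw [hc]; linarith [min_le_left 1 (ε ^ 2)]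
    have h4 : 2 * c ≤ ε ^ 2 := by rw [hc]; linarith [min_le_right 1 (ε ^ 2)]
    have h5 : 2 * c * (J : ℝ) ^ 2 ≤ ε ^ 2 * (J : ℝ) ^ 2 := by gcongr
    nlinarith [mul_nonneg hc0.le (sq_nonneg ((J : ℝ) - 1))]
  have hs : -(s : ℝ) / 2 ≤ 0 := by rw [neg_div, neg_nonpos]; positivity
  calc besselWeight n s ξ ≤ (c * ((J : ℝ) + 1) ^ 2) ^ (-(s : ℝ) / 2) :=
        Real.rpow_le_rpow_of_nonpos (by positivity) h1 hs
    _ = _ := by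
        rw [Real.mul_rpow hc0.le (by positivity), ← Real.rpow_natCast ((J : ℝ) + 1) 2,
          ← Real.rpow_mul (by positivity)]
        congr 2
        push_cast
        ring

theorem exists_cutoff {n : ℕ} {Ω : Set (Euc n)} (hb : Bornology.IsBounded Ω) :
    ∃ χ : Euc n → ℂ, ContDiff ℝ ∞ χ ∧ HasCompactSupport χ ∧ ∀ x ∈ Ω, χ x = 1 := by
  obtain ⟨r, hr⟩ := hb.subset_closedBall 0
  -- `|r| + 1` is a positive radius even when `r ≤ 0`.
  let f : ContDiffBump (0 : Euc n) := ⟨|r| + 1, |r| + 2, by positivity, by linarith⟩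
  refine ⟨fun x => Complex.ofRealCLM (f x), Complex.ofRealCLM.contDiff.comp f.contDiff,
    f.hasCompactSupport.comp_left (g := Complex.ofRealCLM) (map_zero _), fun x hx => ?_⟩
  have h : f x = 1 := f.one_of_mem_closedBall <|
    Metric.closedBall_subset_closedBall (by linarith [le_abs_self r] : r ≤ |r| + 1) (hr hx)
  simp [h]

/-- Functions on `Ω` orthogonal to sufficiently many trigonometric functions have small pairing with
Sobolev functions. -/
theorem exists_abs_inner_restrictL2_le {n : ℕ} (hn : 0 < n) (s : ℝ≥0) {Ω : Set (Euc n)}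
    (hΩ : IsOpen Ω) (hb : Bornology.IsBounded Ω) :
    ∃ C : ℝ, 0 < C ∧ ∀ J : ℕ, ∃ S : Submodule ℝ (RealL2 ((volume : Measure (Euc n)).restrict Ω)),
      FiniteDimensional ℝ S ∧ Module.finrank ℝ S ≤ (4 * J) ^ n ∧ ∀ v ∈ Sᗮ, ∀ w : SobolevRn n s,
        |inner ℝ v (restrictL2 n s Ω w)| ≤ C * ((J : ℝ) + 1) ^ (-(s : ℝ)) * ‖v‖ * ‖w‖ := by
  have : IsFiniteMeasure ((volume : Measure (Euc n)).restrict Ω) :=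
    ⟨by simpa using hb.measure_lt_top⟩
  have hm := hΩ.measurableSet
  obtain ⟨χ, hχ, hχc, hχ1⟩ := exists_cutoff hb
  obtain ⟨δ, hδ, hkey⟩ := lintegral_weightedFourier_le s hχ hχc
  have hn' : (0 : ℝ) < n := by exact_mod_cast hn
  set ε := δ / n with hε
  have hε0 : 0 < ε := by positivity
  set c := (min 1 (ε ^ 2) / 2) ^ (-(s : ℝ) / 2)
  have hc0 : 0 < c := by positivity
  refine ⟨2 * c, by positivity, fun J => ⟨trigSpan Ω ε J, inferInstance,
    finrank_trigSpan_le hn _ _, fun v hv w => (abs_inner_restrictL2_le s hm v w).trans ?_⟩⟩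
  gcongr
  set z := complexExtension hm v with hz
  let D : Set (Euc n) := {ξ | ∀ i, -(ε * J) ≤ ξ i ∧ ξ i < ε * J}
  have hD : MeasurableSet D := by
    have : D = ⋂ i, (fun ξ : Euc n => ξ i) ⁻¹' Set.Ico (-(ε * J)) (ε * J) := by
      ext ξ; simp [D]
    rw [this]
    exact MeasurableSet.iInter fun i => measurableSet_Ico.preimage (by fun_prop)
  have h1 := hkey z (integrable_complexExtension hm v) (by
    filter_upwards [complexExtension_coeFn hm v] with x hx
    rw [hz, hx]
    by_cases h : x ∈ Ω
    · simp [h, hχ1 x h]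
    · simp [h]) D hD fun ξ hξ => exists_zero_near hn hm hδ hv hξ
  set a : ℝ := c * ((J : ℝ) + 1) ^ (-(s : ℝ))
  have ha : 0 ≤ a := by positivity
  have h2 : ∫⁻ ξ in Dᶜ, weightedFourier s z ξ ^ 2 ≤ ENNReal.ofReal ((a * ‖v‖) ^ 2) := by
    calc ∫⁻ ξ in Dᶜ, weightedFourier s z ξ ^ 2
        ≤ ∫⁻ ξ in Dᶜ, ENNReal.ofReal a ^ 2 *
            ‖(𝓕 z : Lp ℂ 2 (volume : Measure (Euc n))) ξ‖ₑ ^ 2 := by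
          refine setLIntegral_mono_ae' hD.compl (.of_forall fun ξ hξ => ?_)
          rw [← mul_pow]
          refine pow_le_pow_left' (mul_le_mul_left (ENNReal.ofReal_le_ofReal ?_) _) 2
          refine besselWeight_le_of_le_norm s hε0 J ?_
          simp only [D, Set.mem_compl_iff, Set.mem_ofPred_eq, not_forall, not_and_or, not_le,
            not_lt] at hξ
          obtain ⟨i, hi⟩ := hξ
          refine le_trans ?_ (PiLp.norm_apply_le ξ i)
          rw [Real.norm_eq_abs, le_abs]
          rcases hi with hi | hi
          · right; linarith
          · left; exact hi
      _ ≤ ∫⁻ ξ, ENNReal.ofReal a ^ 2 *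
            ‖(𝓕 z : Lp ℂ 2 (volume : Measure (Euc n))) ξ‖ₑ ^ 2 := setLIntegral_le_lintegral _ _
      _ = _ := by
          rw [lintegral_const_mul' _ _ (by finiteness), lintegral_enorm_sq_Lp,
            norm_fourier_complexExtension, mul_pow, ← ENNReal.ofReal_pow ha,
            ← ENNReal.ofReal_mul (by positivity)]
  rw [← ofReal_norm_besselMul_sq] at h1
  have h3 := h1.trans (mul_le_mul_right h2 2)
  have e2 : 2 * ENNReal.ofReal ((a * ‖v‖) ^ 2) = ENNReal.ofReal (2 * (a * ‖v‖) ^ 2) := by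
    rw [ENNReal.ofReal_mul zero_le_two, ENNReal.ofReal_ofNat]
  rw [e2, ENNReal.ofReal_le_ofReal_iff (by positivity)] at h3
  have hav : 0 ≤ a * ‖v‖ := by positivity
  -- The factor `√2` from `h3` is rounded up to `2`.
  calc _ ≤ 2 * (a * ‖v‖) := by
        refine abs_le_of_sq_le_sq' (h3.trans ?_) (by positivity) |>.2
        nlinarith
    _ = _ := by simp only [a]; ring

/-- The residual `v = A q - P A q` lies in `Sᗮ`, so `‖v‖² = ⟪v, A q⟫` and the hypothesis can be
tested on `v` itself. -/
theorem norm_sub_starProjection_comp_le {H K : Type*} [NormedAddCommGroup H] [NormedSpace ℝ H]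
    [NormedAddCommGroup K] [InnerProductSpace ℝ K] (A : H →L[ℝ] K) (S : Submodule ℝ K)
    [S.HasOrthogonalProjection] {ε : ℝ} (hε : 0 ≤ ε)
    (h : ∀ v ∈ Sᗮ, ∀ q, |inner ℝ v (A q)| ≤ ε * ‖v‖ * ‖q‖) :
    ‖A - S.starProjection ∘L A‖ ≤ ε := by
  refine ContinuousLinearMap.opNorm_le_bound _ hε fun q => ?_
  obtain ⟨v, hv⟩ : ∃ v, v = A q - S.starProjection (A q) := ⟨_, rfl⟩
  have hvS : v ∈ Sᗮ := hv ▸ S.sub_starProjection_mem_orthogonal _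
  have h1 : ‖v‖ ^ 2 ≤ (ε * ‖q‖) * ‖v‖ := by
    calc ‖v‖ ^ 2 = inner ℝ v (A q) := by
          rw [← real_inner_self_eq_norm_sq]
          nth_rw 2 [hv]
          rw [inner_sub_right,
            Submodule.inner_left_of_mem_orthogonal (S.starProjection_apply_mem _) hvS, sub_zero]
      _ ≤ _ := (le_abs_self _).trans ((h v hvS q).trans (le_of_eq (by ring)))
  change ‖A q - S.starProjection (A q)‖ ≤ _
  rw [← hv]
  rcases (norm_nonneg v).eq_or_lt with h0 | h0
  · rw [← h0]; positivity
  · exact le_of_mul_le_mul_right (by rwa [sq] at h1) h0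

/-- Every element of `H^s(Ω)` has an extension of the same norm. -/
theorem SobolevOn.exists_extension {n : ℕ} {s : ℝ≥0} {Ω : Set (Euc n)} (q : SobolevOn n s Ω) :
    ∃ w : SobolevRn n s, SobolevOn.toL2 n s Ω q = restrictL2 n s Ω w ∧ ‖w‖ = ‖q‖ := by
  let q' : SobolevRn n s ⧸ vanishing n s Ω := q
  let e := (vanishing n s Ω).quotientEquivOrthogonal
  refine ⟨(e q' : SobolevRn n s), ?_, e.norm_map q'⟩
  have h1 : e.symm (e q') = Submodule.Quotient.mk (e q' : SobolevRn n s) :=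
    (vanishing n s Ω).quotientEquivOrthogonal_symm_eq_mk _ (e q').2
  rw [e.symm_apply_apply] at h1
  change (vanishing n s Ω).liftQL (restrictL2 n s Ω) le_rfl q' = _
  conv_lhs => rw [h1]
  rfl

/-- The trigonometric spaces have dimension bounds `(4 * J) ^ n` only, so the largest `J` that fits
into `m` is used; `J = 0` always fits because `n > 0`. -/
theorem exists_pow_le_lt_pow {n : ℕ} (hn : 0 < n) (m : ℕ) :
    ∃ J : ℕ, (4 * J) ^ n ≤ m ∧ m + 1 ≤ (4 * (J + 1)) ^ n := by
  have hex : ∃ J : ℕ, m < (4 * (J + 1)) ^ n :=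
    ⟨m, lt_of_lt_of_le (by omega) (Nat.le_self_pow hn.ne' _)⟩
  refine ⟨Nat.find hex, ?_, Nat.find_spec hex⟩
  rcases hf : Nat.find hex with _ | j
  · simp [hn.ne']
  · exact not_lt.1 (Nat.find_min hex (m := j) (by omega))

theorem rpow_neg_le_of_le_pow {n J m : ℕ} (hn : 0 < n) (s : ℝ≥0)
    (h : m + 1 ≤ (4 * (J + 1)) ^ n) :
    ((J : ℝ) + 1) ^ (-(s : ℝ)) ≤ 4 ^ (s : ℝ) * ((m : ℝ) + 1) ^ (-((s : ℝ) / n)) := by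
  have hn' : (n : ℝ) ≠ 0 := by exact_mod_cast hn.ne'
  have h1 : (m : ℝ) + 1 ≤ (4 * ((J : ℝ) + 1)) ^ (n : ℝ) := by
    rw [Real.rpow_natCast]; exact_mod_cast h
  have h2 : (4 * ((J : ℝ) + 1)) ^ (-(s : ℝ)) ≤ ((m : ℝ) + 1) ^ (-((s : ℝ) / n)) := by
    calc (4 * ((J : ℝ) + 1)) ^ (-(s : ℝ))
        = ((4 * ((J : ℝ) + 1)) ^ (n : ℝ)) ^ (-((s : ℝ) / n)) := by
          rw [← Real.rpow_mul (by positivity)]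
          congr 1
          field_simp
      _ ≤ _ := Real.rpow_le_rpow_of_nonpos (by positivity) h1
          (by rw [neg_nonpos]; positivity)
  rw [Real.mul_rpow (by norm_num) (by positivity), Real.rpow_neg (by norm_num),
    inv_mul_le_iff₀ (by positivity)] at h2
  exact h2

/-- Approximation of the embedding `H^s(Ω) → L²(Ω)` by operators of finite rank. -/
theorem exists_finrank_approx {n : ℕ} (hn : 0 < n) (s : ℝ≥0) {Ω : Set (Euc n)}
    (hΩ : IsOpen Ω) (hb : Bornology.IsBounded Ω) :
    ∃ C : ℝ, 0 < C ∧ ∀ m : ℕ, ∃ (S : Submodule ℝ (RealL2 ((volume : Measure (Euc n)).restrict Ω)))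
      (_ : FiniteDimensional ℝ S), Module.finrank ℝ S ≤ m ∧
        ‖SobolevOn.toL2 n s Ω - S.starProjection ∘L SobolevOn.toL2 n s Ω‖ ≤
          C * ((m : ℝ) + 1) ^ (-((s : ℝ) / n)) := by
  obtain ⟨C, hC, h⟩ := exists_abs_inner_restrictL2_le hn s hΩ hb
  refine ⟨C * 4 ^ (s : ℝ), by positivity, fun m => ?_⟩
  obtain ⟨J, hJ1, hJ2⟩ := exists_pow_le_lt_pow hn m
  obtain ⟨S, hS, hSm, hSv⟩ := h J
  refine ⟨S, hS, hSm.trans hJ1, (norm_sub_starProjection_comp_le _ S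
    (ε := C * ((J : ℝ) + 1) ^ (-(s : ℝ))) (by positivity) fun v hv q => ?_).trans ?_⟩
  · obtain ⟨w, hw, hwn⟩ := q.exists_extension
    rw [hw, ← hwn]
    exact hSv v hv w
  · rw [mul_assoc]
    exact mul_le_mul_of_nonneg_left (rpow_neg_le_of_le_pow hn s hJ2) hC.le

/-! ### Low-rank approximation in tensor products -/

section FiniteRank

variable {H₁ H₂ K₁ K₂ : Type*} [NormedAddCommGroup H₁] [InnerProductSpace ℝ H₁]
  [NormedAddCommGroup H₂] [InnerProductSpace ℝ H₂] [NormedAddCommGroup K₁] [InnerProductSpace ℝ K₁]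
  [NormedAddCommGroup K₂] [InnerProductSpace ℝ K₂]

/-- The map `H₁ ⊗ H₂ → K₂` that contracts the first factor with the functional `φ`, extended to
the completion. -/
def contractLeft (φ : H₁ →L[ℝ] ℝ) (A : H₂ →L[ℝ] K₂) [CompleteSpace K₂] :
    Completion (H₁ ⊗[ℝ] H₂) →L[ℝ] K₂ :=
  ((TensorProduct.lidIsometry ℝ K₂ : _ →L[ℝ] K₂) ∘L TensorProduct.mapL φ A).extend
    Completion.toComplL

/-- The map `H₁ ⊗ H₂ → K₁` that contracts the second factor with the functional `φ`, extended to
the completion. -/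
def contractRight (A : H₁ →L[ℝ] K₁) (φ : H₂ →L[ℝ] ℝ) [CompleteSpace K₁] :
    Completion (H₁ ⊗[ℝ] H₂) →L[ℝ] K₁ :=
  (((TensorProduct.lidIsometry ℝ K₁ : _ →L[ℝ] K₁) ∘L
    (TensorProduct.commIsometry ℝ K₁ ℝ : K₁ ⊗[ℝ] ℝ →L[ℝ] ℝ ⊗[ℝ] K₁)) ∘L TensorProduct.mapL A φ).extend
      Completion.toComplL

theorem extend_toComplL_coe {H K : Type*} [NormedAddCommGroup H] [NormedSpace ℝ H]
    [NormedAddCommGroup K] [NormedSpace ℝ K] [CompleteSpace K] (T : H →L[ℝ] K) (x : H) :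
    T.extend (Completion.toComplL (𝕜 := ℝ)) (x : Completion H) = T x :=
  T.extend_eq (e := Completion.toComplL (𝕜 := ℝ)) Completion.denseRange_coe
    (Completion.isUniformInducing_coe _) x

theorem contractLeft_coe_tmul (φ : H₁ →L[ℝ] ℝ) (A : H₂ →L[ℝ] K₂) [CompleteSpace K₂] (u : H₁)
    (v : H₂) : contractLeft φ A ((u ⊗ₜ[ℝ] v : H₁ ⊗[ℝ] H₂) : Completion (H₁ ⊗[ℝ] H₂)) =
      φ u • A v := by
  rw [contractLeft, extend_toComplL_coe]
  simp

theorem contractRight_coe_tmul (A : H₁ →L[ℝ] K₁) (φ : H₂ →L[ℝ] ℝ) [CompleteSpace K₁] (u : H₁)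
    (v : H₂) : contractRight A φ ((u ⊗ₜ[ℝ] v : H₁ ⊗[ℝ] H₂) : Completion (H₁ ⊗[ℝ] H₂)) =
      φ v • A u := by
  rw [contractRight, extend_toComplL_coe]
  simp

theorem starProjection_eq_sum_inner {K : Type*} [NormedAddCommGroup K] [InnerProductSpace ℝ K]
    {S : Submodule ℝ K} [FiniteDimensional ℝ S] {ι : Type*} [Fintype ι]
    (b : OrthonormalBasis ι ℝ S) (x : K) :
    S.starProjection x = ∑ i, inner ℝ (b i : K) x • (b i : K) := by
  rw [b.starProjection_eq_sum_rankOne]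
  simp

/-- Low rank approximation in the tensor product of two operators, each close to an operator of
finite rank. -/
theorem exists_sum_tmul_approx [CompleteSpace K₁] [CompleteSpace K₂] {L : Type*}
    [NormedAddCommGroup L] [InnerProductSpace ℝ L] [CompleteSpace L]
    (Φ : K₁ ⊗[ℝ] K₂ →ₗᵢ[ℝ] L) (A₁ : H₁ →L[ℝ] K₁) (A₂ : H₂ →L[ℝ] K₂) (S₁ : Submodule ℝ K₁)
    (S₂ : Submodule ℝ K₂) [FiniteDimensional ℝ S₁] [FiniteDimensional ℝ S₂]
    (f : Completion (H₁ ⊗[ℝ] H₂)) :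
    ∃ (g : Fin (Module.finrank ℝ S₁) ⊕ Fin (Module.finrank ℝ S₂) → K₁)
      (h : Fin (Module.finrank ℝ S₁) ⊕ Fin (Module.finrank ℝ S₂) → K₂),
      ‖(Φ.toContinuousLinearMap ∘L TensorProduct.mapL A₁ A₂).extend Completion.toComplL f -
        ∑ r, Φ (g r ⊗ₜ[ℝ] h r)‖ ≤
        ‖A₁ - S₁.starProjection ∘L A₁‖ * ‖A₂ - S₂.starProjection ∘L A₂‖ * ‖f‖ := by
  let b₁ := stdOrthonormalBasis ℝ S₁
  let b₂ := stdOrthonormalBasis ℝ S₂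
  set B₁ := A₁ - S₁.starProjection ∘L A₁ with hB₁
  set B₂ := A₂ - S₂.starProjection ∘L A₂ with hB₂
  -- Expanding `P₁` and `P₂` in orthonormal bases writes `P₁A₁⊗A₂` and `B₁⊗P₂A₂` as separable sums.
  -- Taking `B₁` rather than `A₁` in the second makes the remainder exactly `B₁⊗B₂`.
  refine ⟨Sum.elim (fun i => (b₁ i : K₁)) (fun j => contractRight B₁
      (innerSL ℝ (b₂ j : K₂) ∘L A₂) f), Sum.elim (fun i => contractLeft
      (innerSL ℝ (b₁ i : K₁) ∘L A₁) A₂ f) (fun j => (b₂ j : K₂)), ?_⟩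
  simp only [Fintype.sum_sum_type, Sum.elim_inl, Sum.elim_inr]
  -- Both sides are continuous in `f`, so the algebraic tensor product suffices.
  induction f using Completion.induction_on with
  | hp =>
    refine isClosed_le ?_ (by fun_prop)
    have hΦ := Φ.continuous
    fun_prop
  | ih x =>
    have key : (Φ.toContinuousLinearMap ∘L TensorProduct.mapL A₁ A₂).extend
        Completion.toComplL (x : Completion (H₁ ⊗[ℝ] H₂)) -
        (∑ i, Φ ((b₁ i : K₁) ⊗ₜ[ℝ] contractLeft (innerSL ℝ (b₁ i : K₁) ∘L A₁) A₂
            (x : Completion (H₁ ⊗[ℝ] H₂))) +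
          ∑ j, Φ (contractRight B₁ (innerSL ℝ (b₂ j : K₂) ∘L A₂)
            (x : Completion (H₁ ⊗[ℝ] H₂)) ⊗ₜ[ℝ] (b₂ j : K₂))) =
        Φ (TensorProduct.mapL B₁ B₂ x) := by
      induction x with
      | zero => simp [Completion.coe_zero]
      | add x y hx hy =>
        simp only [Completion.coe_add, map_add, TensorProduct.tmul_add, TensorProduct.add_tmul,
          Finset.sum_add_distrib] at hx hy ⊢
        rw [← hx, ← hy]
        abel
      | tmul u v =>
        simp only [contractLeft_coe_tmul, contractRight_coe_tmul]
        rw [extend_toComplL_coe]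
        have e₁ : ∑ i, Φ ((b₁ i : K₁) ⊗ₜ[ℝ] ((innerSL ℝ (b₁ i : K₁) ∘L A₁) u • A₂ v)) =
            Φ (S₁.starProjection (A₁ u) ⊗ₜ[ℝ] A₂ v) := by
          rw [starProjection_eq_sum_inner b₁, TensorProduct.sum_tmul, map_sum]
          simp [TensorProduct.tmul_smul, TensorProduct.smul_tmul']
        have e₂ : ∑ j, Φ (((innerSL ℝ (b₂ j : K₂) ∘L A₂) v • B₁ u) ⊗ₜ[ℝ] (b₂ j : K₂)) =
            Φ (B₁ u ⊗ₜ[ℝ] S₂.starProjection (A₂ v)) := by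
          rw [starProjection_eq_sum_inner b₂, TensorProduct.tmul_sum, map_sum]
          simp [TensorProduct.tmul_smul, TensorProduct.smul_tmul']
        rw [e₁, e₂]
        simp only [TensorProduct.mapL_tmul, ContinuousLinearMap.comp_apply,
          LinearIsometry.coe_toContinuousLinearMap]
        rw [← map_add, ← map_sub]
        congr 1
        simp only [hB₁, hB₂, sub_apply, ContinuousLinearMap.comp_apply,
          TensorProduct.sub_tmul, TensorProduct.tmul_sub]
        abel
    rw [key, Φ.norm_map, Completion.norm_coe]
    exact ((TensorProduct.mapL B₁ B₂).le_opNorm x).trans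
      (mul_le_mul_of_nonneg_right (TensorProduct.norm_mapL_le B₁ B₂) (norm_nonneg x))

end FiniteRank

/-! ### Rank approximation in the mixed space -/

theorem RankApprox.mono {n₁ n₂ : ℕ} {Ω₁ : Set (Euc n₁)} {Ω₂ : Set (Euc n₂)}
    {f : RealL2 ((volume.restrict Ω₁).prod (volume.restrict Ω₂))} {R : ℕ} {ε ε' : ℝ}
    (h : RankApprox Ω₁ Ω₂ f R ε) (hε : ε ≤ ε') : RankApprox Ω₁ Ω₂ f R ε' := by
  obtain ⟨g, g', hg⟩ := h
  exact ⟨g, g', hg.trans hε⟩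

theorem separable_eq_tensorToL2 {α β : Type*} [MeasurableSpace α] [MeasurableSpace β]
    (μ : Measure α) (ν : Measure β) [SFinite μ] [SFinite ν] (u : RealL2 μ) (v : RealL2 ν) :
    separable μ ν u v = tensorToL2 μ ν (u ⊗ₜ[ℝ] v) := rfl

/-- Unused places among the `R` summands are filled with zeros. -/
theorem RankApprox.of_fintype {n₁ n₂ : ℕ} {Ω₁ : Set (Euc n₁)} {Ω₂ : Set (Euc n₂)}
    {f : RealL2 ((volume.restrict Ω₁).prod (volume.restrict Ω₂))} {R : ℕ} {ε : ℝ} {ι : Type*}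
    [Fintype ι] (hι : Fintype.card ι ≤ R) (g : ι → RealL2 (volume.restrict Ω₁))
    (h : ι → RealL2 (volume.restrict Ω₂))
    (hε : ‖f - ∑ r, separable (volume.restrict Ω₁) (volume.restrict Ω₂) (g r) (h r)‖ ≤ ε) :
    RankApprox Ω₁ Ω₂ f R ε := by
  obtain ⟨e⟩ : Nonempty (ι ↪ Fin R) :=
    Function.Embedding.nonempty_of_card_le (by simpa using hι)
  refine ⟨Function.extend e g 0, Function.extend e h 0, ?_⟩
  convert hε using 3
  symm
  refine Finset.sum_of_injOn e e.injective.injOn (by simp) (fun i _ hi => ?_) fun i _ => ?_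
  · have hi' : ¬ ∃ a, e a = i := by simpa using hi
    rw [Function.extend_apply' _ _ _ hi', separable_eq_tensorToL2]
    simp
  · rw [e.injective.extend_apply, e.injective.extend_apply]

/-- Low rank approximation in the mixed Sobolev space at the rate given by the two embeddings. -/
theorem exists_rankApprox {n₁ n₂ : ℕ} (hn₁ : 0 < n₁) (hn₂ : 0 < n₂)
    {Ω₁ : Set (Euc n₁)} (hΩ₁ : IsOpen Ω₁) (hb₁ : Bornology.IsBounded Ω₁)
    {Ω₂ : Set (Euc n₂)} (hΩ₂ : IsOpen Ω₂) (hb₂ : Bornology.IsBounded Ω₂) (s₁ s₂ : ℝ≥0) :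
    ∃ C : ℝ, 0 < C ∧ ∀ f : SobolevMix n₁ n₂ s₁ s₂ Ω₁ Ω₂, ∀ R : ℕ, 1 ≤ R →
      RankApprox Ω₁ Ω₂ (SobolevMix.toL2 n₁ n₂ s₁ s₂ Ω₁ Ω₂ f) R
        (C * (R : ℝ) ^ (-((s₁ : ℝ) / n₁ + (s₂ : ℝ) / n₂)) * ‖f‖) := by
  obtain ⟨C₁, hC₁, h₁⟩ := exists_finrank_approx hn₁ s₁ hΩ₁ hb₁
  obtain ⟨C₂, hC₂, h₂⟩ := exists_finrank_approx hn₂ s₂ hΩ₂ hb₂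
  set γ : ℝ := (s₁ : ℝ) / n₁ + (s₂ : ℝ) / n₂ with hγ
  have hγ0 : 0 ≤ γ := by positivity
  refine ⟨C₁ * C₂ * 2 ^ γ, by positivity, fun f R hR => ?_⟩
  -- Each factor gets half of the rank, rounded down. For `R = 1` this is `0`, which the bound in `m
  -- + 1` allows; `R / 2 ≤ ⌊R / 2⌋ + 1` then costs the constant `2 ^ γ`.
  obtain ⟨S₁, hS₁, hd₁, ha₁⟩ := h₁ (R / 2)
  obtain ⟨S₂, hS₂, hd₂, ha₂⟩ := h₂ (R / 2)
  obtain ⟨g, h, hgh⟩ := exists_sum_tmul_approx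
    (tensorToL2 (volume.restrict Ω₁) (volume.restrict Ω₂))
    (SobolevOn.toL2 n₁ s₁ Ω₁) (SobolevOn.toL2 n₂ s₂ Ω₂) S₁ S₂ f
  refine RankApprox.of_fintype (by simp; omega) g h (hgh.trans (mul_le_mul_of_nonneg_right ?_ (norm_nonneg f)))
  have hR' : (0 : ℝ) < R := by exact_mod_cast hR
  have h3 : (R : ℝ) / 2 ≤ ((R / 2 : ℕ) : ℝ) + 1 := by
    have : R ≤ 2 * (R / 2 + 1) := by omega
    have : (R : ℝ) ≤ 2 * (((R / 2 : ℕ) : ℝ) + 1) := by exact_mod_cast this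
    linarith
  calc _ ≤ (C₁ * (((R / 2 : ℕ) : ℝ) + 1) ^ (-((s₁ : ℝ) / n₁))) *
        (C₂ * (((R / 2 : ℕ) : ℝ) + 1) ^ (-((s₂ : ℝ) / n₂))) := by gcongr
    _ = C₁ * C₂ * (((R / 2 : ℕ) : ℝ) + 1) ^ (-γ) := by
        rw [hγ, neg_add, Real.rpow_add (by positivity)]
        ring
    _ ≤ C₁ * C₂ * ((R : ℝ) / 2) ^ (-γ) := by
        gcongr 1
        exact Real.rpow_le_rpow_of_nonpos (by positivity) h3 (by linarith)
    _ = _ := by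
        rw [Real.div_rpow hR'.le (by norm_num), Real.rpow_neg (by norm_num : (0 : ℝ) ≤ 2),
          div_inv_eq_mul]
        ring

/-! ### The exponent and the main theorem -/

theorem rankExponent_eq {n₁ n₂ : ℕ} (s₁ s₂ : ℝ≥0) {σ : ℝ} (hσ : 0 < σ) :
    rankExponent n₁ n₂ s₁ s₂ σ = 1 / ((n₁ : ℝ) * n₂) *
      min ((s₁ : ℝ) * n₁ / σ ^ 2 + s₁ * n₂) ((s₂ : ℝ) * n₁ + s₂ * n₂ * σ ^ 2) := by
  have e₁ : (s₁ : ℝ) * n₁ / σ ^ 2 + s₁ * n₂ = ((n₁ : ℝ) / σ + σ * n₂) * ((s₁ : ℝ) / σ) := by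
    field_simp
  have e₂ : (s₂ : ℝ) * n₁ + s₂ * n₂ * σ ^ 2 = ((n₁ : ℝ) / σ + σ * n₂) * (s₂ * σ) := by
    field_simp
  rw [e₁, e₂, ← mul_min_of_nonneg _ _ (by positivity), rankExponent]
  ring

/-- The prefactor splits as `1/(σ n₂) + σ/n₁`; bounding the minimum by `s₂ σ` against the first term
and by `s₁/σ` against the second cancels `σ`. -/
theorem rankExponent_le {n₁ n₂ : ℕ} (hn₁ : 0 < n₁) (hn₂ : 0 < n₂) (s₁ s₂ : ℝ≥0) {σ : ℝ}
    (hσ : 0 < σ) : rankExponent n₁ n₂ s₁ s₂ σ ≤ (s₁ : ℝ) / n₁ + (s₂ : ℝ) / n₂ := by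
  have h₁ : (0 : ℝ) < n₁ := by exact_mod_cast hn₁
  have h₂ : (0 : ℝ) < n₂ := by exact_mod_cast hn₂
  have hm₁ := min_le_left ((s₁ : ℝ) / σ) (s₂ * σ)
  have hm₂ := min_le_right ((s₁ : ℝ) / σ) (s₂ * σ)
  rw [rankExponent]
  calc _ = 1 / (σ * n₂) * min ((s₁ : ℝ) / σ) (s₂ * σ) + σ / n₁ * min ((s₁ : ℝ) / σ) (s₂ * σ) := by
        field_simp
    _ ≤ 1 / (σ * n₂) * (s₂ * σ) + σ / n₁ * ((s₁ : ℝ) / σ) := by gcongr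
    _ = _ := by field_simp; ring

theorem rankExponent_sqrt {n₁ n₂ : ℕ} (hn₁ : 0 < n₁) (hn₂ : 0 < n₂) {s₁ s₂ : ℝ≥0} (hs₁ : 0 < s₁)
    (hs₂ : 0 < s₂) :
    rankExponent n₁ n₂ s₁ s₂ (√((s₁ : ℝ) / s₂)) = (s₁ : ℝ) / n₁ + (s₂ : ℝ) / n₂ := by
  have h₁ : (0 : ℝ) < n₁ := by exact_mod_cast hn₁
  have h₂ : (0 : ℝ) < n₂ := by exact_mod_cast hn₂
  have hs₁' : (0 : ℝ) < s₁ := hs₁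
  have hs₂' : (0 : ℝ) < s₂ := hs₂
  rw [rankExponent_eq s₁ s₂ (by positivity), Real.sq_sqrt (by positivity)]
  have e₁ : (s₁ : ℝ) * n₁ / ((s₁ : ℝ) / s₂) + s₁ * n₂ = s₂ * n₁ + s₁ * n₂ := by field_simp
  have e₂ : (s₂ : ℝ) * n₁ + s₂ * n₂ * ((s₁ : ℝ) / s₂) = s₂ * n₁ + s₁ * n₂ := by field_simp
  rw [e₁, e₂, min_self]
  field_simp
  ring

end MixedSobolev

end

open MixedSobolev in
theorem mainTheorem2 (n₁ n₂ : ℕ) (hn₁ : 0 < n₁) (hn₂ : 0 < n₂)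
    (Ω₁ : Set (Euc n₁)) (hΩ₁ : IsOpen Ω₁) (hb₁ : Bornology.IsBounded Ω₁)
    (Ω₂ : Set (Euc n₂)) (hΩ₂ : IsOpen Ω₂) (hb₂ : Bornology.IsBounded Ω₂)
    (s₁ s₂ : ℝ≥0) (hs₁ : 0 < s₁) (hs₂ : 0 < s₂) :
    (∀ σ : ℝ, 0 < σ →
      rankExponent n₁ n₂ s₁ s₂ σ =
        1 / ((n₁ : ℝ) * n₂) *
          min ((s₁ : ℝ) * n₁ / σ ^ 2 + s₁ * n₂) ((s₂ : ℝ) * n₁ + s₂ * n₂ * σ ^ 2) ∧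
      ((s₁ : ℝ) / σ ≠ s₂ * σ →
        ∃ C : ℝ, 0 < C ∧ ∀ f : SobolevMix n₁ n₂ s₁ s₂ Ω₁ Ω₂, ∀ R : ℕ, 1 ≤ R →
          RankApprox Ω₁ Ω₂ (SobolevMix.toL2 n₁ n₂ s₁ s₂ Ω₁ Ω₂ f) R
            (C * (R : ℝ) ^ (-rankExponent n₁ n₂ s₁ s₂ σ) * ‖f‖)) ∧
      ((s₁ : ℝ) / σ = s₂ * σ →
        ∃ C : ℝ, 0 < C ∧ ∀ f : SobolevMix n₁ n₂ s₁ s₂ Ω₁ Ω₂, ∀ R : ℕ, 2 ≤ R →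
          RankApprox Ω₁ Ω₂ (SobolevMix.toL2 n₁ n₂ s₁ s₂ Ω₁ Ω₂ f) R
            (C * (R : ℝ) ^ (-rankExponent n₁ n₂ s₁ s₂ σ) * √(Real.log R) * ‖f‖))) ∧
    rankExponent n₁ n₂ s₁ s₂ (√((s₁ : ℝ) / s₂)) = (s₁ : ℝ) / n₁ + (s₂ : ℝ) / n₂ ∧
    ∃ C : ℝ, 0 < C ∧ ∀ f : SobolevMix n₁ n₂ s₁ s₂ Ω₁ Ω₂, ∀ R : ℕ, 2 ≤ R →
      RankApprox Ω₁ Ω₂ (SobolevMix.toL2 n₁ n₂ s₁ s₂ Ω₁ Ω₂ f) R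
        (C * (R : ℝ) ^ (-((s₁ : ℝ) / n₁ + (s₂ : ℝ) / n₂)) * √(Real.log R) * ‖f‖) := by
  obtain ⟨C, hC, hf⟩ := exists_rankApprox hn₁ hn₂ hΩ₁ hb₁ hΩ₂ hb₂ s₁ s₂
  have hlow : ∀ β : ℝ, β ≤ (s₁ : ℝ) / n₁ + (s₂ : ℝ) / n₂ →
      ∀ f : SobolevMix n₁ n₂ s₁ s₂ Ω₁ Ω₂, ∀ R : ℕ, 1 ≤ R →
        RankApprox Ω₁ Ω₂ (SobolevMix.toL2 n₁ n₂ s₁ s₂ Ω₁ Ω₂ f) R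
          (C * (R : ℝ) ^ (-β) * ‖f‖) := by
    intro β hβ f R hR
    have hR' : (1 : ℝ) ≤ R := by exact_mod_cast hR
    refine (hf f R hR).mono ?_
    gcongr
  have hlog : ∀ β : ℝ, β ≤ (s₁ : ℝ) / n₁ + (s₂ : ℝ) / n₂ →
      ∃ C : ℝ, 0 < C ∧ ∀ f : SobolevMix n₁ n₂ s₁ s₂ Ω₁ Ω₂, ∀ R : ℕ, 2 ≤ R →
        RankApprox Ω₁ Ω₂ (SobolevMix.toL2 n₁ n₂ s₁ s₂ Ω₁ Ω₂ f) R
          (C * (R : ℝ) ^ (-β) * √(Real.log R) * ‖f‖) := by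
    intro β hβ
    -- For `R ≥ 2` the logarithmic factor is at least `√(log 2) > 0`, so it can be inserted by
    -- enlarging the constant.
    have h2 : 0 < √(Real.log 2) := Real.sqrt_pos.2 (Real.log_pos one_lt_two)
    refine ⟨C / √(Real.log 2), by positivity, fun f R hR => ?_⟩
    have hR' : (2 : ℝ) ≤ R := by exact_mod_cast hR
    refine (hlow β hβ f R (by omega)).mono ?_
    refine mul_le_mul_of_nonneg_right ?_ (norm_nonneg f)
    have h3 : √(Real.log 2) ≤ √(Real.log R) :=
      Real.sqrt_le_sqrt (Real.log_le_log two_pos hR')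
    calc C * (R : ℝ) ^ (-β) = C / √(Real.log 2) * (R : ℝ) ^ (-β) * √(Real.log 2) := by
          field_simp
      _ ≤ _ := by gcongr
  exact ⟨fun σ hσ => ⟨rankExponent_eq s₁ s₂ hσ,
    fun _ => ⟨C, hC, hlow _ (rankExponent_le hn₁ hn₂ s₁ s₂ hσ)⟩,
    fun _ => hlog _ (rankExponent_le hn₁ hn₂ s₁ s₂ hσ)⟩,
    rankExponent_sqrt hn₁ hn₂ hs₁ hs₂, hlog _ le_rfl⟩
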